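/- Let $d\ge 1$ and let $V=(V(x;\omega))_{x\in\mathbb Z^d}$ be a family of independent, identically distributed real random variables on a probability space $(\Omega,\mathcal F,\mathbb P)$, whose common distribution function $F_V(t)=\mathbb P\{V(0;\omega)\le t\}$ is uniformly Hölder continuous: for some $b>0$ and $C<\infty$, $F_V(t+\epsilon)-F_V(t)\le C\,\epsilon^{b}$ for all $t\in\mathbb R$ and all $\epsilon\in[0,1]$. For $g\in\mathbb R$ let $H(\omega)=-\Delta+gV(\cdot\,;\omega)$ in $\ell^2(\mathbb Z^d)$, where $(\Delta\psi)(x)=\sum_{|y-x|_1=1}(\psi(y)-\psi(x))$, with domain $\{\psi\in\ell^2(\mathbb Z^d): H(\omega)\psi\in\ell^2(\mathbb Z^d)\}$. Let $\|x\|=\max_j|x_j|$ denote the max-norm on $\mathbb Z^d$. Then for every $m>0$ there exists $g_0<\infty$ such that for every $g$ with $|g|\ge g_0$ the following holds for $\mathbb P$-almost every $\omega$: for every eigenfunction $\psi\in\ell^2(\mathbb Z^d)$ of $H(\omega)$ with $\|\psi\|_{\ell^2}=1$ there is $R=R(\omega,\psi)<\infty$ such that $$|\psi(y)|\le e^{-m\|y\|}\qquad\text{for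 all } y\in\mathbb Z^d \text{ with } \|y\|\ge R .$$ -/

import Mathlib

open MeasureTheory ProbabilityTheory
open scoped ENNReal

namespace Anderson

/-- The lattice `ℤ^d`. Its Mathlib norm is the max-norm `‖x‖ = max_j |x_j|`. -/
abbrev Lattice (d : ℕ) : Type := Fin d → ℤ

/-- The Hilbert space `ℓ²(ℤ^d)` of complex-valued square-summable functions. -/
abbrev EllTwo (d : ℕ) : Type := lp (fun _ : Lattice d => ℂ) 2

/-- The nearest-neighbour lattice Laplacian
`(Δψ)(x) = ∑_{y : |y - x|₁ = 1} (ψ(y) - ψ(x))`, acting on all functions on `ℤ^d`. -/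
noncomputable def laplacian {d : ℕ} (ψ : Lattice d → ℂ) (x : Lattice d) : ℂ :=
  ∑ j : Fin d, (ψ (x + Pi.single j 1) + ψ (x - Pi.single j 1) - 2 * ψ x)

/-- The action `ψ ↦ -Δψ + g v ψ` on all functions on `ℤ^d`, for a potential `v`. -/
noncomputable def formalHamiltonian {d : ℕ} (g : ℝ) (v : Lattice d → ℝ) :
    (Lattice d → ℂ) →ₗ[ℂ] (Lattice d → ℂ) where
  toFun ψ := fun x => -laplacian ψ x + (g : ℂ) * (v x : ℂ) * ψ x
  map_add' ψ φ := by
    funext x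
    have h : laplacian (ψ + φ) x = laplacian ψ x + laplacian φ x := by
      simp only [laplacian, Pi.add_apply, ← Finset.sum_add_distrib]
      exact Finset.sum_congr rfl fun j _ => by ring
    simp only [h, Pi.add_apply]
    ring
  map_smul' c ψ := by
    funext x
    have h : laplacian (c • ψ) x = c * laplacian ψ x := by
      simp only [laplacian, Pi.smul_apply, smul_eq_mul, Finset.mul_sum]
      exact Finset.sum_congr rfl fun j _ => by ring
    simp only [h, Pi.smul_apply, smul_eq_mul, RingHom.id_apply]
    ring

/-- The (possibly unbounded) operator `H = -Δ + g v` in `ℓ²(ℤ^d)`, on its natural maximal domain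
`{ψ ∈ ℓ² : Hψ ∈ ℓ²}`. As `Δ` is bounded, this is the domain of multiplication by `g v`. -/
noncomputable def hamiltonian {d : ℕ} (g : ℝ) (v : Lattice d → ℝ) :
    EllTwo d →ₗ.[ℂ] EllTwo d where
  domain :=
    { carrier := {ψ | Memℓp (formalHamiltonian g v (ψ : Lattice d → ℂ)) 2}
      add_mem' := by
        intro ψ φ hψ hφ
        simp only [Set.mem_ofPred_eq, lp.coeFn_add, map_add] at *
        exact hψ.add hφ
      zero_mem' := by
        simp only [Set.mem_ofPred_eq, lp.coeFn_zero, map_zero]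
        exact zero_memℓp
      smul_mem' := by
        intro c ψ hψ
        simp only [Set.mem_ofPred_eq, lp.coeFn_smul, map_smul] at *
        exact hψ.const_smul c }
  toFun :=
    { toFun := fun ψ => ⟨formalHamiltonian g v ((ψ : EllTwo d) : Lattice d → ℂ), ψ.2⟩
      map_add' := fun ψ φ => by
        apply Subtype.ext
        simp only [Submodule.coe_add, lp.coeFn_add, map_add]
        rfl
      map_smul' := fun c ψ => by
        apply Subtype.ext
        simp only [Submodule.coe_smul, lp.coeFn_smul, map_smul]
        rfl }

/-- `ψ` is a normalized eigenfunction of the operator `H` in `ℓ²(ℤ^d)`. -/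
def IsNormalizedEigenfunction {d : ℕ} (H : EllTwo d →ₗ.[ℂ] EllTwo d) (ψ : EllTwo d) : Prop :=
  ‖ψ‖ = 1 ∧ ∃ (hψ : ψ ∈ H.domain) (E : ℂ), H ⟨ψ, hψ⟩ = E • ψ

/-- The distribution function `F_X(t) = P(X ≤ t)` of a real random variable. -/
noncomputable def distributionFunction {Ω : Type*} [MeasurableSpace Ω] (P : Measure Ω)
    (X : Ω → ℝ) (t : ℝ) : ℝ :=
  P.real {ω | X ω ≤ t}

/-- Uniform Hölder continuity of a distribution function: for some `b > 0` and some constant `C`,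
`F(t + ε) - F(t) ≤ C ε^b` for all real `t` and all `ε ∈ [0, 1]`. -/
def UniformlyHolder (F : ℝ → ℝ) : Prop :=
  ∃ b : ℝ, 0 < b ∧ ∃ C : ℝ, ∀ t : ℝ, ∀ ε ∈ Set.Icc (0 : ℝ) 1, F (t + ε) - F t ≤ C * ε ^ b

end Anderson

/-! The argument has three layers.

Fixed energy. Removing a site `x` from a finite set factors the Green function as `G_S(x,y) = -(g
v(x) - σ)⁻¹ ∑ T(x,z) G_{S∖x}(z,y)`, where neither `σ` nor `G_{S∖x}` involves `v(x)`. Hölder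
continuity makes the moment of order `-s` of `g v(x) - σ` finite uniformly in `σ`, and of size
`|g|^(-s)`. For `|g|` large each hop therefore costs a factor `e^(-κ)`, and the fractional moments
of `G` decay exponentially with any prescribed rate (`lintegral_green_le`).

All energies at once. Off an event of small probability, a Green function that is not small across a
box of radius `L` forces `E` to lie within `e^(-L)` of the spectrum of the box
(`measure_exists_green_gt_le`); this uses a fine grid of energies and the stability of the
resolvent. The same moments give a Wegner bound, since near an eigenvalue some resolvent entry is
huge. By independence, two disjoint boxes rarely have nearby eigenvalues, hence are rarely singular
at a common energy (`measure_exists_singular_le`). No multiscale induction is needed.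

Eigenfunctions. Borel–Cantelli excludes, almost surely and for large `L`, common singularity of the
box at `x` and boxes at distance about `3L`. If `ψ x ≠ 0`, the Poisson formula makes the box at `x`
singular at the eigenvalue for all large `L`; so the box at `y`, with `L ≈ ‖x - y‖ / 3`, is
nonsingular, and the same formula bounds `ψ y`. -/

namespace Anderson

/-! ### Schur complements and removal of a site. -/

section Masked

variable {ι : Type*} [DecidableEq ι]

/-- The matrix `T + g v` restricted to `S × S`, and the identity outside of `S`. -/
def maskedMatrix (T : Matrix ι ι ℝ) (g : ℝ) (S : Finset ι) (v : ι → ℝ) : Matrix ι ι ℝ :=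
  fun x y => if x ∈ S ∧ y ∈ S then T x y + (if x = y then g * v x else 0)
    else if x = y then 1 else 0

theorem maskedMatrix_update_of_notMem (T : Matrix ι ι ℝ) (g : ℝ) {S : Finset ι} {x : ι}
    (hx : x ∉ S) (v : ι → ℝ) (t : ℝ) :
    maskedMatrix T g S (Function.update v x t) = maskedMatrix T g S v := by
  ext y z
  unfold maskedMatrix
  by_cases hy : y = x
  · subst hy; simp [hx]
  · simp [Function.update_of_ne hy]

theorem continuous_maskedMatrix (T : Matrix ι ι ℝ) (g : ℝ) (S : Finset ι) :
    Continuous (maskedMatrix T g S) := by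
  refine continuous_pi fun x => continuous_pi fun y => ?_
  unfold maskedMatrix
  split_ifs <;> fun_prop

variable [Fintype ι]

theorem maskedMatrix_univ (T : Matrix ι ι ℝ) (g : ℝ) (v : ι → ℝ) :
    maskedMatrix T g Finset.univ v = T + Matrix.diagonal (fun x => g * v x) := by
  ext x y
  simp [maskedMatrix, Matrix.diagonal_apply]

theorem measurable_inv_apply {α : Type*} [MeasurableSpace α] [TopologicalSpace α]
    [OpensMeasurableSpace α] {M : α → Matrix ι ι ℝ}
    (hM : Continuous M) (x y : ι) : Measurable fun a => (M a)⁻¹ x y := by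
  simp only [Matrix.inv_def, Ring.inverse_eq_inv', Matrix.smul_apply, smul_eq_mul]
  refine Measurable.mul (Measurable.inv ?_) ?_
  · exact hM.matrix_det.measurable
  · exact (hM.matrix_adjugate.matrix_elem x y).measurable

theorem vecMul_maskedMatrix_of_mem (T : Matrix ι ι ℝ) (g : ℝ) {S : Finset ι} (v f : ι → ℝ)
    {z : ι} (hz : z ∈ S) :
    Matrix.vecMul f (maskedMatrix T g S v) z = f z * (g * v z) + ∑ w ∈ S, f w * T w z := by
  have h : ∀ w, f w * maskedMatrix T g S v w z =
      if w ∈ S then f w * T w z + (if w = z then f z * (g * v z) else 0) else 0 := by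
    intro w
    unfold maskedMatrix
    by_cases hw : w ∈ S
    · by_cases hwz : w = z
      · subst hwz; simp [hw]; ring
      · simp [hw, hz, hwz]
    · have : w ≠ z := fun h => hw (h ▸ hz)
      simp [hw, this]
  simp only [Matrix.vecMul, dotProduct, h]
  rw [← Finset.sum_filter]
  simp [Finset.sum_add_distrib, hz, add_comm]

theorem vecMul_maskedMatrix_of_notMem (T : Matrix ι ι ℝ) (g : ℝ) {S : Finset ι} (v f : ι → ℝ)
    {z : ι} (hz : z ∉ S) :
    Matrix.vecMul f (maskedMatrix T g S v) z = f z := by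
  simp [Matrix.vecMul, dotProduct, maskedMatrix, hz]

/-- The self-energy of the site `x`: the correction to the diagonal entry in the Schur complement
of `S \ {x}` in `S`. -/
noncomputable def selfEnergy (T : Matrix ι ι ℝ) (g : ℝ) (S : Finset ι) (x : ι) (v : ι → ℝ) : ℝ :=
  ∑ w ∈ S.erase x, (∑ z ∈ S.erase x, T x z * (maskedMatrix T g (S.erase x) v)⁻¹ z w) * T w x
    - T x x

theorem selfEnergy_update (T : Matrix ι ι ℝ) (g : ℝ) (S : Finset ι) (x : ι) (v : ι → ℝ) (t : ℝ) :
    selfEnergy T g S x (Function.update v x t) = selfEnergy T g S x v := by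
  simp [selfEnergy, maskedMatrix_update_of_notMem]

theorem measurable_selfEnergy (T : Matrix ι ι ℝ) (g : ℝ) (S : Finset ι) (x : ι) :
    Measurable (selfEnergy T g S x) := by
  unfold selfEnergy
  refine Measurable.sub_const (Finset.measurable_sum _ fun w _ => Measurable.mul_const
    (Finset.measurable_sum _ fun z _ => Measurable.const_mul ?_ _) _) _
  exact measurable_inv_apply (continuous_maskedMatrix T g _) _ _

/-- Away from `x`, the row vector `f` solves the system of `S.erase x` with source `-f x * T x ·`.
Solving it and substituting into the equation in column `x` leaves a scalar equation for `f x`. -/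
theorem schur_complement {T : Matrix ι ι ℝ} {g : ℝ} {S : Finset ι} {v f : ι → ℝ} {x : ι} {r : ℝ}
    (hx : x ∈ S) (hdet : (maskedMatrix T g (S.erase x) v).det ≠ 0)
    (hf : Matrix.vecMul f (maskedMatrix T g S v) = Pi.single x r) :
    (∀ y, y ≠ x → f y =
      -f x * ∑ z ∈ S.erase x, T x z * (maskedMatrix T g (S.erase x) v)⁻¹ z y) ∧
    f x * (g * v x - selfEnergy T g S x v) = r := by
  set K := (maskedMatrix T g (S.erase x) v)⁻¹ with hK
  have key : Matrix.vecMul (Function.update f x 0) (maskedMatrix T g (S.erase x) v) =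
      fun z => if z ∈ S.erase x then -f x * T x z else 0 := by
    funext z
    by_cases hz : z ∈ S.erase x
    · have hzx : z ≠ x := Finset.ne_of_mem_erase hz
      have hzS := Finset.mem_of_mem_erase hz
      have h1 := congrFun hf z
      rw [vecMul_maskedMatrix_of_mem T g v f hzS, Pi.single_eq_of_ne hzx,
        ← Finset.add_sum_erase _ _ hx] at h1
      rw [vecMul_maskedMatrix_of_mem T g v _ hz, if_pos hz, Function.update_of_ne hzx]
      have h2 : ∑ w ∈ S.erase x, Function.update f x 0 w * T w z = ∑ w ∈ S.erase x, f w * T w z :=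
        Finset.sum_congr rfl fun w hw => by
          rw [Function.update_of_ne (Finset.ne_of_mem_erase hw)]
      rw [h2]; linarith
    · rw [vecMul_maskedMatrix_of_notMem T g v _ hz, if_neg hz]
      by_cases hzx : z = x
      · subst hzx; simp
      · have hzS : z ∉ S := fun h => hz (Finset.mem_erase.2 ⟨hzx, h⟩)
        have h1 := congrFun hf z
        rw [vecMul_maskedMatrix_of_notMem T g v f hzS, Pi.single_eq_of_ne hzx] at h1
        rw [Function.update_of_ne hzx, h1]
  have hsol : ∀ y, y ≠ x → f y = -f x * ∑ z ∈ S.erase x, T x z * K z y := by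
    intro y hy
    have h1 : Matrix.vecMul (Matrix.vecMul (Function.update f x 0)
        (maskedMatrix T g (S.erase x) v)) K = Function.update f x 0 := by
      rw [Matrix.vecMul_vecMul, hK, Matrix.mul_nonsing_inv _ (isUnit_iff_ne_zero.2 hdet),
        Matrix.vecMul_one]
    have h2 := congrFun h1 y
    rw [key, Function.update_of_ne hy] at h2
    rw [← h2, Finset.mul_sum]
    simp only [Matrix.vecMul, dotProduct, ite_mul, zero_mul]
    rw [← Finset.sum_filter]
    simp only [Finset.filter_univ_mem, mul_assoc]
  refine ⟨hsol, ?_⟩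
  have h1 := congrFun hf x
  rw [vecMul_maskedMatrix_of_mem T g v f hx, Pi.single_eq_same, ← Finset.add_sum_erase _ _ hx] at h1
  have h2 : ∑ w ∈ S.erase x, f w * T w x =
      -f x * ∑ w ∈ S.erase x, (∑ z ∈ S.erase x, T x z * K z w) * T w x := by
    rw [Finset.mul_sum]
    exact Finset.sum_congr rfl fun w hw => by
      rw [hsol w (Finset.ne_of_mem_erase hw)]; ring
  rw [h2] at h1
  rw [← h1, selfEnergy]
  ring

theorem det_maskedMatrix_ne_zero {T : Matrix ι ι ℝ} {g : ℝ} {S : Finset ι} {v : ι → ℝ} {x : ι}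
    (hx : x ∈ S) (hdet : (maskedMatrix T g (S.erase x) v).det ≠ 0)
    (hc : g * v x - selfEnergy T g S x v ≠ 0) : (maskedMatrix T g S v).det ≠ 0 := by
  intro h0
  obtain ⟨f, hf0, hf⟩ := Matrix.exists_vecMul_eq_zero_iff.2 h0
  obtain ⟨h1, h2⟩ := schur_complement (r := 0) hx hdet (by rw [hf, Pi.single_zero])
  have hfx : f x = 0 := by simpa [hc] using h2
  apply hf0
  funext y
  by_cases hy : y = x
  · rw [hy, hfx]; rfl
  · rw [h1 y hy, hfx]; simp

/-- Row `x` of the inverse is the case `r = 1` of `schur_complement`. The point is the product form: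
`v x` enters only the scalar factor. -/
theorem green_schur {T : Matrix ι ι ℝ} {g : ℝ} {S : Finset ι} {v : ι → ℝ} {x : ι}
    (hx : x ∈ S) (hdet : (maskedMatrix T g (S.erase x) v).det ≠ 0)
    (hdet' : (maskedMatrix T g S v).det ≠ 0) :
    (maskedMatrix T g S v)⁻¹ x x = (g * v x - selfEnergy T g S x v)⁻¹ ∧
    g * v x - selfEnergy T g S x v ≠ 0 ∧
    ∀ y, y ≠ x → (maskedMatrix T g S v)⁻¹ x y = -(g * v x - selfEnergy T g S x v)⁻¹ *
      ∑ z ∈ S.erase x, T x z * (maskedMatrix T g (S.erase x) v)⁻¹ z y := by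
  have h := schur_complement (f := fun y => (maskedMatrix T g S v)⁻¹ x y) (r := 1) hx hdet (by
    have h := Matrix.nonsing_inv_mul (maskedMatrix T g S v) (isUnit_iff_ne_zero.2 hdet')
    funext z
    have := congrFun (congrFun h x) z
    rw [Matrix.mul_apply, Matrix.one_apply] at this
    simp only [Matrix.vecMul, dotProduct, this, Pi.single_apply, eq_comm])
  have hne : g * v x - selfEnergy T g S x v ≠ 0 := right_ne_zero_of_mul_eq_one h.2
  have hxx := eq_inv_of_mul_eq_one_left h.2
  refine ⟨hxx, hne, fun y hy => ?_⟩
  rw [h.1 y hy, hxx]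

end Masked

/-! ### Fractional moments of Green functions. -/

section FractionalMoments

variable {ι : Type*} [Fintype ι] [DecidableEq ι]

theorem lintegral_pi_update (μ : Measure ℝ) [IsProbabilityMeasure μ] (x : ι)
    {f : (ι → ℝ) → ℝ≥0∞} (hf : Measurable f) :
    ∫⁻ v, f v ∂Measure.pi (fun _ : ι => μ) =
      ∫⁻ v, ∫⁻ t, f (Function.update v x t) ∂μ ∂Measure.pi (fun _ : ι => μ) := by
  have hF : Measurable fun v => ∫⁻ t, f (Function.update v x t) ∂μ := by
    have h : Measurable fun p : (ι → ℝ) × ℝ => f (Function.update p.1 x p.2) := by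
      refine hf.comp (measurable_pi_iff.2 fun i => ?_)
      by_cases hi : i = x
      · subst hi; simpa using measurable_snd
      · simp only [Function.update_of_ne hi]
        fun_prop
    exact h.lintegral_prod_right'
  rw [lintegral_eq_lmarginal_univ (fun _ => 0), lintegral_eq_lmarginal_univ (fun _ => 0),
    lmarginal_erase' f hf (Finset.mem_univ x), lmarginal_erase' _ hF (Finset.mem_univ x)]
  simp

/-- Integrating out the potential at `x`, from which `c` and `F` do not depend. -/
theorem lintegral_enorm_rpow_mul_le {μ : Measure ℝ} [IsProbabilityMeasure μ] {g s : ℝ} {K : ℝ≥0∞}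
    (hK : ∀ c : ℝ, ∫⁻ t, ‖g * t - c‖ₑ ^ (-s) ∂μ ≤ K) (x : ι)
    {c : (ι → ℝ) → ℝ} {F : (ι → ℝ) → ℝ≥0∞} (hc : Measurable c) (hF : Measurable F)
    (hcx : ∀ v t, c (Function.update v x t) = c v) (hFx : ∀ v t, F (Function.update v x t) = F v) :
    ∫⁻ v, ‖g * v x - c v‖ₑ ^ (-s) * F v ∂Measure.pi (fun _ : ι => μ) ≤
      K * ∫⁻ v, F v ∂Measure.pi (fun _ : ι => μ) := by
  rw [lintegral_pi_update μ x (by fun_prop), ← lintegral_const_mul _ hF]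
  refine lintegral_mono fun v => ?_
  simp only [hcx, hFx, Function.update_self]
  rw [lintegral_mul_const _ (by fun_prop)]
  gcongr
  exact hK _

/-- Adding one site keeps the matrix invertible unless `g * v x` equals the self-energy. There the
power `-s` is infinite, which its finite integral permits only on a null set. -/
theorem ae_det_maskedMatrix_ne_zero {μ : Measure ℝ} [IsProbabilityMeasure μ] {g s : ℝ}
    {K : ℝ≥0∞} (hs : 0 < s) (hKtop : K ≠ ∞) (hK : ∀ c : ℝ, ∫⁻ t, ‖g * t - c‖ₑ ^ (-s) ∂μ ≤ K)
    (T : Matrix ι ι ℝ) (S : Finset ι) :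
    ∀ᵐ v ∂Measure.pi (fun _ : ι => μ), (maskedMatrix T g S v).det ≠ 0 := by
  induction S using Finset.induction_on with
  | empty =>
    refine Filter.Eventually.of_forall fun v => ?_
    have : maskedMatrix T g ∅ v = 1 := by
      ext x y; simp [maskedMatrix, Matrix.one_apply]
    simp [this]
  | insert x S hx ih =>
    have hxS : x ∈ insert x S := Finset.mem_insert_self _ _
    have he : (insert x S).erase x = S := Finset.erase_insert hx
    have h := lintegral_enorm_rpow_mul_le hK x (F := fun _ => 1)
      (measurable_selfEnergy T g (insert x S) x) measurable_const
      (selfEnergy_update T g (insert x S) x) (fun _ _ => rfl)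
    have hm := measurable_selfEnergy T g (insert x S) x
    have hfin : ∀ᵐ v ∂Measure.pi (fun _ : ι => μ),
        ‖g * v x - selfEnergy T g (insert x S) x v‖ₑ ^ (-s) * 1 < ∞ := by
      refine ae_lt_top (by fun_prop) (ne_top_of_le_ne_top ?_ h)
      simpa using hKtop
    filter_upwards [ih, hfin] with v h1 h2
    refine det_maskedMatrix_ne_zero hxS (by rwa [he]) fun h0 => ?_
    rw [h0] at h2
    simp [hs] at h2

theorem enorm_sum_rpow_le {α : Type*} (S : Finset α) (f : α → ℝ) {s : ℝ} (hs : 0 < s)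
    (hs1 : s ≤ 1) : ‖∑ i ∈ S, f i‖ₑ ^ s ≤ ∑ i ∈ S, ‖f i‖ₑ ^ s := by
  classical
  induction S using Finset.induction_on with
  | empty => simp [hs]
  | insert i S hi ih =>
    rw [Finset.sum_insert hi, Finset.sum_insert hi]
    calc _ ≤ (‖f i‖ₑ + ‖∑ i ∈ S, f i‖ₑ) ^ s :=
          ENNReal.rpow_le_rpow (enorm_add_le _ _) hs.le
      _ ≤ ‖f i‖ₑ ^ s + ‖∑ i ∈ S, f i‖ₑ ^ s := ENNReal.rpow_add_le_add_rpow _ _ hs.le hs1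
      _ ≤ _ := by gcongr

/-- Exponential decay of the fractional moments of the Green functions at strong disorder,
by iterating the Schur complement formula. -/
theorem lintegral_green_le {μ : Measure ℝ} [IsProbabilityMeasure μ] {g s κ : ℝ}
    {K : ℝ≥0∞} (hs : 0 < s) (hs1 : s ≤ 1) (hKtop : K ≠ ∞) (hκ : 0 ≤ κ)
    (hK : ∀ c : ℝ, ∫⁻ t, ‖g * t - c‖ₑ ^ (-s) ∂μ ≤ K)
    {T : Matrix ι ι ℝ} {D : ι → ι → ℝ} (hD0 : ∀ x, D x x ≤ 0)
    (hD : ∀ x z, z ≠ x → T x z ≠ 0 → ∀ y, D x y ≤ D z y + 1)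
    (hT : ∀ x, (∑ z ∈ Finset.univ.erase x, ‖T x z‖ₑ ^ s) * K ≤ ENNReal.ofReal (Real.exp (-κ)))
    (S : Finset ι) : ∀ x ∈ S, ∀ y ∈ S,
    ∫⁻ v, ‖(maskedMatrix T g S v)⁻¹ x y‖ₑ ^ s ∂Measure.pi (fun _ : ι => μ) ≤
      K * ENNReal.ofReal (Real.exp (-κ * D x y)) := by
  induction hn : S.card generalizing S with
  | zero => intro x hx; simp [Finset.card_eq_zero.1 hn] at hx
  | succ n ih =>
  intro x hx y hy
  have hcard : (S.erase x).card = n := by rw [Finset.card_erase_of_mem hx, hn]; rfl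
  have hdet := ae_det_maskedMatrix_ne_zero hs hKtop hK T (S.erase x)
  have hdet' := ae_det_maskedMatrix_ne_zero hs hKtop hK T S
  have hmc := measurable_selfEnergy T g S x
  have hinv : ∀ a : ℝ, a ≠ 0 → ‖a⁻¹‖ₑ ^ s = ‖a‖ₑ ^ (-s) := fun a ha => by
    rw [enorm_inv ha, ENNReal.inv_rpow, ENNReal.rpow_neg]
  by_cases hxy : y = x
  · subst hxy
    have h := lintegral_enorm_rpow_mul_le hK y (F := fun _ => 1) hmc measurable_const
      (selfEnergy_update T g S y) (fun _ _ => rfl)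
    calc _ ≤ ∫⁻ v, ‖g * v y - selfEnergy T g S y v‖ₑ ^ (-s) * 1 ∂Measure.pi (fun _ : ι => μ) := by
          refine lintegral_mono_ae ?_
          filter_upwards [hdet, hdet'] with v h1 h2
          obtain ⟨h3, h4, -⟩ := green_schur hx h1 h2
          rw [h3, hinv _ h4, mul_one]
      _ ≤ K * 1 := by simpa using h
      _ ≤ _ := by
        gcongr
        rw [ENNReal.one_le_ofReal, Real.one_le_exp_iff]
        nlinarith [hD0 y]
  · have hyS : y ∈ S.erase x := Finset.mem_erase.2 ⟨hxy, hy⟩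
    -- Since `s ≤ 1`, the power of the sum is at most this sum of powers, and it does not depend on
    -- `v x`.
    set F : (ι → ℝ) → ℝ≥0∞ := fun v => ∑ z ∈ S.erase x,
      ‖T x z‖ₑ ^ s * ‖(maskedMatrix T g (S.erase x) v)⁻¹ z y‖ₑ ^ s with hFdef
    have hmG : ∀ z, Measurable fun v => ‖(maskedMatrix T g (S.erase x) v)⁻¹ z y‖ₑ ^ s := fun z =>
      (measurable_inv_apply (continuous_maskedMatrix T g _) z y).enorm.pow_const s
    have hmF : Measurable F := Finset.measurable_sum _ fun z _ => (hmG z).const_mul _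
    have h := lintegral_enorm_rpow_mul_le hK x (F := F) hmc hmF
      (selfEnergy_update T g S x) (fun v t => by
        simp only [hFdef, maskedMatrix_update_of_notMem T g (Finset.notMem_erase x S)])
    have hF : ∫⁻ v, F v ∂Measure.pi (fun _ : ι => μ) ≤
        (∑ z ∈ Finset.univ.erase x, ‖T x z‖ₑ ^ s) *
          (K * ENNReal.ofReal (Real.exp (-κ * (D x y - 1)))) := by
      rw [lintegral_finsetSum _ (fun z _ => (hmG z).const_mul _), Finset.sum_mul]
      refine (Finset.sum_le_sum fun z hz => ?_).trans
        (Finset.sum_le_sum_of_subset (Finset.erase_subset_erase x (Finset.subset_univ S)))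
      rw [lintegral_const_mul _ (hmG z)]
      by_cases hTz : T x z = 0
      · simp [hTz, hs]
      · gcongr
        refine (ih _ hcard z hz y hyS).trans ?_
        gcongr 1
        refine ENNReal.ofReal_le_ofReal (Real.exp_le_exp.2 ?_)
        -- A hop shortens the distance to `y` by at most one; the factor `exp κ` lost here is
        -- recovered from `hT`.
        nlinarith [hD x z (Finset.ne_of_mem_erase hz) hTz y]
    calc _ ≤ ∫⁻ v, ‖g * v x - selfEnergy T g S x v‖ₑ ^ (-s) * F v ∂Measure.pi (fun _ : ι => μ) := by
          refine lintegral_mono_ae ?_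
          filter_upwards [hdet, hdet'] with v h1 h2
          obtain ⟨-, h4, h5⟩ := green_schur hx h1 h2
          rw [h5 y hxy, neg_mul, enorm_neg, enorm_mul, ENNReal.mul_rpow_of_nonneg _ _ hs.le,
            hinv _ h4]
          gcongr
          refine (enorm_sum_rpow_le _ _ hs hs1).trans (le_of_eq ?_)
          simp only [enorm_mul, ENNReal.mul_rpow_of_nonneg _ _ hs.le, hFdef]
      _ ≤ K * ((∑ z ∈ Finset.univ.erase x, ‖T x z‖ₑ ^ s) *
          (K * ENNReal.ofReal (Real.exp (-κ * (D x y - 1))))) := h.trans (by gcongr)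
      _ = K * ((∑ z ∈ Finset.univ.erase x, ‖T x z‖ₑ ^ s) * K *
          ENNReal.ofReal (Real.exp (-κ * (D x y - 1)))) := by ring
      _ ≤ K * (ENNReal.ofReal (Real.exp (-κ)) *
          ENNReal.ofReal (Real.exp (-κ * (D x y - 1)))) := by gcongr; exact hT x
      _ = _ := by
        rw [← ENNReal.ofReal_mul (Real.exp_pos _).le, ← Real.exp_add]
        congr 3; ring

end FractionalMoments

/-! ### Negative moments of the single-site law. -/

section Moments

theorem measure_Icc_le_of_holder {μ : Measure ℝ} [IsProbabilityMeasure μ] {b C : ℝ}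
    (hC : ∀ t : ℝ, ∀ ε ∈ Set.Icc (0 : ℝ) 1, μ.real (Set.Iic (t + ε)) - μ.real (Set.Iic t) ≤ C * ε ^ b)
    (c : ℝ) {r : ℝ} (hr : 0 < r) (hr1 : 3 * r ≤ 1) :
    μ (Set.Icc (c - r) (c + r)) ≤ ENNReal.ofReal (C * (3 * r) ^ b) := by
  -- Increments of the distribution function measure half-open intervals, so the left end is moved
  -- out to include `c - r`.
  have hsub : Set.Icc (c - r) (c + r) ⊆ Set.Iic (c - 2 * r + 3 * r) \ Set.Iic (c - 2 * r) := by
    rintro t ⟨h1, h2⟩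
    refine ⟨?_, ?_⟩
    · simp only [Set.mem_Iic]; linarith
    · simp only [Set.mem_Iic, not_le]; linarith
  refine (measure_mono hsub).trans ?_
  rw [← ENNReal.ofReal_toReal (measure_ne_top μ _)]
  refine ENNReal.ofReal_le_ofReal ?_
  change μ.real _ ≤ _
  rw [measureReal_sdiff (Set.Iic_subset_Iic.2 (by linarith)) measurableSet_Iic]
  exact hC _ _ ⟨by positivity, hr1⟩

/-- Dyadic layers: for `0 < |u| ≤ 1/4`, some `n` has `2^(-n) / 8 < |u| ≤ 2^(-n) / 4`, and the term
`n` alone suffices. At `u = 0` both sides are infinite. The scale `1/4` keeps `3 * r ≤ 1` in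
`measure_Icc_le_of_holder`. -/
theorem enorm_rpow_neg_le_tsum {s : ℝ} (hs : 0 < s) (u : ℝ) :
    ‖u‖ₑ ^ (-s) ≤ ENNReal.ofReal (4 ^ s) + ∑' k : ℕ, ENNReal.ofReal ((8 * 2 ^ k) ^ s) *
      Set.indicator {u : ℝ | |u| ≤ 1 / 4 * (1 / 2) ^ k} (fun _ => 1) u := by
  by_cases hu0 : u = 0
  · subst hu0
    have : ∑' k : ℕ, ENNReal.ofReal ((8 * 2 ^ k) ^ s) *
        Set.indicator {u : ℝ | |u| ≤ 1 / 4 * (1 / 2) ^ k} (fun _ => (1 : ℝ≥0∞)) 0 = ∞ := by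
      refine top_unique ?_
      rw [← ENNReal.tsum_const_eq_top_of_ne_zero (α := ℕ) (c := 1) one_ne_zero]
      refine ENNReal.tsum_le_tsum fun k => ?_
      rw [Set.indicator_of_mem (by simp), mul_one, ENNReal.one_le_ofReal]
      refine Real.one_le_rpow ?_ hs.le
      have : (1 : ℝ) ≤ 2 ^ k := one_le_pow₀ (by norm_num)
      linarith
    rw [this]; simp
  have hpos : 0 < |u| := abs_pos.2 hu0
  have hval : ∀ a : ℝ, 0 < a → 1 ≤ a * |u| → ‖u‖ₑ ^ (-s) ≤ ENNReal.ofReal (a ^ s) := by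
    intro a ha h
    rw [Real.enorm_eq_ofReal_abs, ENNReal.ofReal_rpow_of_pos hpos]
    refine ENNReal.ofReal_le_ofReal ?_
    rw [Real.rpow_neg hpos.le, ← Real.inv_rpow hpos.le]
    refine Real.rpow_le_rpow (by positivity) ?_ hs.le
    rwa [inv_le_iff_one_le_mul₀ hpos]
  by_cases hu : 1 / 4 < |u|
  · exact (hval 4 (by norm_num) (by linarith)).trans le_self_add
  · obtain ⟨n, h1, h2⟩ := exists_nat_pow_near_of_lt_one (x := 4 * |u|) (y := (1 / 2 : ℝ))
      (by positivity) (by linarith) (by norm_num) (by norm_num)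
    refine le_trans ?_ (le_trans (ENNReal.le_tsum n) le_add_self)
    rw [Set.indicator_of_mem (by simp only [Set.mem_ofPred_eq]; linarith), mul_one]
    refine hval _ (by positivity) ?_
    have h3 : (2 : ℝ) ^ n * (1 / 2) ^ (n + 1) = 1 / 2 := by
      rw [pow_succ, ← mul_assoc, ← mul_pow]; norm_num
    have h4 : (2 : ℝ) ^ n * (1 / 2) ^ (n + 1) ≤ 2 ^ n * (4 * |u|) := by gcongr
    nlinarith

theorem exists_lintegral_enorm_rpow_le {μ : Measure ℝ} [IsProbabilityMeasure μ]
    (h : UniformlyHolder fun t => μ.real (Set.Iic t)) :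
    ∃ s : ℝ, 0 < s ∧ s ≤ 1 ∧ ∃ C₀ : ℝ≥0∞, C₀ ≠ ∞ ∧
      ∀ c : ℝ, ∫⁻ t, ‖t - c‖ₑ ^ (-s) ∂μ ≤ C₀ := by
  obtain ⟨b, hb, C, hC⟩ := h
  -- The exponent `s` must be below `b`: layer `k` contributes about `2 ^ (k * (s - b))`.
  have hs : 0 < min b 1 / 2 := by positivity
  have hsb : min b 1 / 2 < b := by
    have := min_le_left b 1
    linarith
  have hs1 : min b 1 / 2 ≤ 1 := by
    have := min_le_right b 1
    linarith
  set s := min b 1 / 2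
  have hsum : Summable fun k : ℕ => (8 * 2 ^ k : ℝ) ^ s * (|C| * (3 * (1 / 4 * (1 / 2) ^ k)) ^ b) := by
    have hq : (2 : ℝ) ^ s * (1 / 2) ^ b < 1 := by
      rw [Real.div_rpow (by norm_num) (by norm_num), Real.one_rpow, mul_one_div,
        ← Real.rpow_sub (by norm_num)]
      exact Real.rpow_lt_one_of_one_lt_of_neg (by norm_num) (by linarith)
    have hg := (summable_geometric_of_lt_one (by positivity) hq).mul_left
      (8 ^ s * |C| * (3 / 4) ^ b)
    refine hg.congr fun k => ?_
    have e1 : (3 * (1 / 4 * (1 / 2) ^ k) : ℝ) = 3 / 4 * (1 / 2) ^ k := by ring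
    rw [e1, Real.mul_rpow (by norm_num) (by positivity), Real.mul_rpow (by norm_num) (by positivity),
      ← Real.rpow_pow_comm (by norm_num), ← Real.rpow_pow_comm (by norm_num), mul_pow]
    ring
  refine ⟨s, hs, hs1, ENNReal.ofReal (4 ^ s) + ∑' k : ℕ, ENNReal.ofReal
    ((8 * 2 ^ k : ℝ) ^ s * (|C| * (3 * (1 / 4 * (1 / 2) ^ k)) ^ b)), ?_, fun c => ?_⟩
  · exact ENNReal.add_ne_top.2 ⟨ENNReal.ofReal_ne_top, hsum.tsum_ofReal_ne_top⟩
  have hmeas : ∀ k : ℕ, MeasurableSet {u : ℝ | |u| ≤ 1 / 4 * (1 / 2) ^ k} := fun k =>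
    measurableSet_le (by fun_prop) (by fun_prop)
  have hm : ∀ k : ℕ, Measurable fun t : ℝ => ENNReal.ofReal ((8 * 2 ^ k) ^ s) *
      Set.indicator {u : ℝ | |u| ≤ 1 / 4 * (1 / 2) ^ k} (fun _ => (1 : ℝ≥0∞)) (t - c) := fun k =>
    ((measurable_const.indicator (hmeas k)).comp (measurable_id.sub_const c)).const_mul _
  refine (lintegral_mono fun t => enorm_rpow_neg_le_tsum hs (t - c)).trans ?_
  rw [lintegral_add_left measurable_const, lintegral_const, measure_univ, mul_one,
    lintegral_tsum fun k => (hm k).aemeasurable]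
  gcongr with k
  rw [lintegral_const_mul' _ _ ENNReal.ofReal_ne_top, ENNReal.ofReal_mul (by positivity)]
  gcongr
  have hset : (fun t : ℝ => Set.indicator {u : ℝ | |u| ≤ 1 / 4 * (1 / 2) ^ k}
      (fun _ => (1 : ℝ≥0∞)) (t - c)) = Set.indicator
      (Set.Icc (c - 1 / 4 * (1 / 2) ^ k) (c + 1 / 4 * (1 / 2) ^ k)) 1 := by
    funext t
    simp only [Set.indicator_apply, Set.mem_ofPred_eq, abs_le, Set.mem_Icc, Pi.one_apply]
    congr 1
    exact propext ⟨fun h => ⟨by linarith, by linarith⟩, fun h => ⟨by linarith, by linarith⟩⟩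
  rw [hset, lintegral_indicator_one measurableSet_Icc]
  have h2 : ((1 : ℝ) / 2) ^ k ≤ 1 := pow_le_one₀ (by norm_num) (by norm_num)
  refine (measure_Icc_le_of_holder hC c (by positivity) (by linarith)).trans
    (ENNReal.ofReal_le_ofReal ?_)
  gcongr
  exact le_abs_self C

/-- Scaling: `g * t - c = g * (t - c / g)` extracts the factor `|g| ^ (-s)`, and the moment bound is
uniform in the centre. -/
theorem exists_coupling_lintegral_le {μ : Measure ℝ} {s : ℝ} (hs : 0 < s) {C₀ : ℝ≥0∞}
    (hC₀ : C₀ ≠ ∞) (hC : ∀ c : ℝ, ∫⁻ t, ‖t - c‖ₑ ^ (-s) ∂μ ≤ C₀) {η : ℝ} (hη : 0 < η) :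
    ∃ g₀ : ℝ, ∀ g : ℝ, g₀ ≤ |g| → ∀ c : ℝ, ∫⁻ t, ‖g * t - c‖ₑ ^ (-s) ∂μ ≤ ENNReal.ofReal η := by
  refine ⟨(C₀.toReal / η) ^ (1 / s) + 1, fun g hg c => ?_⟩
  have hpos : 0 < |g| := by
    have : 0 ≤ (C₀.toReal / η) ^ (1 / s) := by positivity
    linarith
  have hg0 : g ≠ 0 := abs_pos.1 hpos
  have h1 : C₀.toReal / η ≤ |g| ^ s := by
    have h := Real.rpow_le_rpow (by positivity) (show (C₀.toReal / η) ^ (1 / s) ≤ |g| by linarith)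
      hs.le
    rwa [← Real.rpow_mul (by positivity), one_div_mul_cancel hs.ne', Real.rpow_one] at h
  have h2 : ∀ t : ℝ, ‖g * t - c‖ₑ ^ (-s) = ENNReal.ofReal (|g| ^ (-s)) * ‖t - c / g‖ₑ ^ (-s) := by
    intro t
    have : g * t - c = g * (t - c / g) := by field_simp
    have hge : ‖g‖ₑ ^ s ≠ 0 := by simp [hg0, hs]
    rw [this, enorm_mul, ENNReal.rpow_neg, ENNReal.mul_rpow_of_nonneg _ _ hs.le,
      ENNReal.mul_inv (Or.inl hge) (Or.inl (ENNReal.rpow_ne_top_of_nonneg hs.le enorm_ne_top)),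
      ← ENNReal.rpow_neg, ← ENNReal.rpow_neg, ← ENNReal.ofReal_rpow_of_pos hpos,
      ← Real.enorm_eq_ofReal_abs]
  simp only [h2]
  rw [lintegral_const_mul' _ _ ENNReal.ofReal_ne_top]
  calc _ ≤ ENNReal.ofReal (|g| ^ (-s)) * C₀ := by gcongr; exact hC _
    _ = ENNReal.ofReal (|g| ^ (-s) * C₀.toReal) := by
      rw [ENNReal.ofReal_mul (by positivity), ENNReal.ofReal_toReal hC₀]
    _ ≤ _ := by
      refine ENNReal.ofReal_le_ofReal ?_
      rw [Real.rpow_neg hpos.le, inv_mul_le_iff₀ (by positivity)]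
      rwa [div_le_iff₀ hη] at h1

end Moments

/-! ### Resolvents of finite Hermitian matrices. -/

section Spectral

variable {ι : Type*} [Fintype ι] [DecidableEq ι]

theorem sub_smul_one_eq_conj {H : Matrix ι ι ℝ} (hH : H.IsHermitian) (E : ℝ) :
    H - E • (1 : Matrix ι ι ℝ) = (hH.eigenvectorUnitary : Matrix ι ι ℝ) *
      Matrix.diagonal (fun i => hH.eigenvalues i - E) *
        star (hH.eigenvectorUnitary : Matrix ι ι ℝ) := by
  have h1 := hH.spectral_theorem
  rw [Unitary.conjStarAlgAut_apply] at h1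
  have h2 : (Matrix.diagonal fun i => hH.eigenvalues i - E) =
      Matrix.diagonal (RCLike.ofReal ∘ hH.eigenvalues) - E • (1 : Matrix ι ι ℝ) := by
    ext i j
    by_cases h : i = j <;> simp [h]
  rw [h2, mul_sub, sub_mul, ← h1]
  simp

theorem resolvent_mul_eq_one {H : Matrix ι ι ℝ} (hH : H.IsHermitian) {E : ℝ}
    (hE : ∀ i, hH.eigenvalues i ≠ E) :
    (H - E • (1 : Matrix ι ι ℝ)) * ((hH.eigenvectorUnitary : Matrix ι ι ℝ) *
      Matrix.diagonal (fun i => (hH.eigenvalues i - E)⁻¹) *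
        star (hH.eigenvectorUnitary : Matrix ι ι ℝ)) = 1 := by
  rw [sub_smul_one_eq_conj hH]
  set U := (hH.eigenvectorUnitary : Matrix ι ι ℝ)
  have hU : star U * U = 1 := Unitary.coe_star_mul_self _
  have hU' : U * star U = 1 := Unitary.coe_mul_star_self _
  have hd : Matrix.diagonal (fun i => hH.eigenvalues i - E) *
      Matrix.diagonal (fun i => (hH.eigenvalues i - E)⁻¹) = (1 : Matrix ι ι ℝ) := by
    rw [Matrix.diagonal_mul_diagonal, ← Matrix.diagonal_one]
    congr 1; funext i
    exact mul_inv_cancel₀ (sub_ne_zero.2 (hE i))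
  calc _ = U * Matrix.diagonal (fun i => hH.eigenvalues i - E) * (star U * U) *
        Matrix.diagonal (fun i => (hH.eigenvalues i - E)⁻¹) * star U := by
        simp only [mul_assoc]
    _ = U * (Matrix.diagonal (fun i => hH.eigenvalues i - E) *
        Matrix.diagonal (fun i => (hH.eigenvalues i - E)⁻¹)) * star U := by
        rw [hU, mul_one, mul_assoc U]
    _ = 1 := by rw [hd, mul_one, hU']

theorem exists_eigenvalues_eq_of_det_eq_zero {H : Matrix ι ι ℝ} (hH : H.IsHermitian) {E : ℝ}
    (hE : (H - E • (1 : Matrix ι ι ℝ)).det = 0) : ∃ i, hH.eigenvalues i = E := by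
  by_contra! h
  have h1 := congrArg Matrix.det (resolvent_mul_eq_one hH h)
  rw [Matrix.det_mul, hE, zero_mul, Matrix.det_one] at h1
  exact zero_ne_one h1

theorem det_sub_eigenvalues {H : Matrix ι ι ℝ} (hH : H.IsHermitian) (i : ι) :
    (H - hH.eigenvalues i • (1 : Matrix ι ι ℝ)).det = 0 := by
  rw [sub_smul_one_eq_conj hH, Matrix.det_mul, Matrix.det_mul, Matrix.det_diagonal,
    Finset.prod_eq_zero (Finset.mem_univ i) (sub_self _)]
  simp

theorem resolvent_apply {H : Matrix ι ι ℝ} (hH : H.IsHermitian) {E : ℝ}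
    (hE : ∀ i, hH.eigenvalues i ≠ E) (x y : ι) :
    (H - E • (1 : Matrix ι ι ℝ))⁻¹ x y =
      ∑ i, (hH.eigenvectorUnitary : Matrix ι ι ℝ) x i *
        (hH.eigenvectorUnitary : Matrix ι ι ℝ) y i * (hH.eigenvalues i - E)⁻¹ := by
  rw [Matrix.inv_eq_right_inv (resolvent_mul_eq_one hH hE), Matrix.mul_apply]
  refine Finset.sum_congr rfl fun i _ => ?_
  rw [Matrix.mul_diagonal, Matrix.star_apply, star_trivial]
  ring

/-- The rows of the eigenvector matrix are unit vectors. This keeps the dimension out of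
`abs_resolvent_sub_le`. -/
theorem sum_abs_eigenvector_le {H : Matrix ι ι ℝ} (hH : H.IsHermitian) (x y : ι) :
    ∑ i, |(hH.eigenvectorUnitary : Matrix ι ι ℝ) x i *
        (hH.eigenvectorUnitary : Matrix ι ι ℝ) y i| ≤ 1 := by
  set U := (hH.eigenvectorUnitary : Matrix ι ι ℝ)
  have hU' : U * star U = 1 := Unitary.coe_mul_star_self _
  have h1 : ∀ x, ∑ i, U x i ^ 2 = 1 := fun x => by
    have := congrFun (congrFun hU' x) x
    rw [Matrix.mul_apply, Matrix.one_apply_eq] at this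
    simpa [sq] using this
  calc _ ≤ ∑ i, (U x i ^ 2 + U y i ^ 2) / 2 := by
        refine Finset.sum_le_sum fun i _ => ?_
        rw [abs_mul, ← sq_abs (U x i), ← sq_abs (U y i)]
        nlinarith [sq_nonneg (|U x i| - |U y i|)]
    _ = 1 := by rw [← Finset.sum_div, Finset.sum_add_distrib, h1, h1]; norm_num

/-- Stability of the Green function in the energy, away from the spectrum. -/
theorem abs_resolvent_sub_le {H : Matrix ι ι ℝ} (hH : H.IsHermitian) {E E' δ ε : ℝ}
    (hδ : 0 < δ) (hE : ∀ E₀, (H - E₀ • (1 : Matrix ι ι ℝ)).det = 0 → δ ≤ |E - E₀|)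
    (hε : |E - E'| ≤ ε) (hεδ : ε ≤ δ / 2) (x y : ι) :
    |(H - E • (1 : Matrix ι ι ℝ))⁻¹ x y - (H - E' • (1 : Matrix ι ι ℝ))⁻¹ x y| ≤
      2 * ε / δ ^ 2 := by
  have h1 : ∀ i, δ ≤ |hH.eigenvalues i - E| := fun i => by
    rw [abs_sub_comm]; exact hE _ (det_sub_eigenvalues hH i)
  have h2 : ∀ i, δ / 2 ≤ |hH.eigenvalues i - E'| := fun i => by
    have := abs_sub_abs_le_abs_sub (hH.eigenvalues i - E) (hH.eigenvalues i - E')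
    rw [show hH.eigenvalues i - E - (hH.eigenvalues i - E') = -(E - E') by ring, abs_neg] at this
    linarith [h1 i]
  have h3 : ∀ i, hH.eigenvalues i ≠ E := fun i h => by
    have := h1 i; rw [h, sub_self, abs_zero] at this; linarith
  have h4 : ∀ i, hH.eigenvalues i ≠ E' := fun i h => by
    have := h2 i; rw [h, sub_self, abs_zero] at this; linarith
  rw [resolvent_apply hH h3, resolvent_apply hH h4, ← Finset.sum_sub_distrib]
  refine (Finset.abs_sum_le_sum_abs _ _).trans ?_
  calc _ ≤ ∑ i, |(hH.eigenvectorUnitary : Matrix ι ι ℝ) x i *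
        (hH.eigenvectorUnitary : Matrix ι ι ℝ) y i| * (2 * ε / δ ^ 2) := by
        refine Finset.sum_le_sum fun i _ => ?_
        rw [← mul_sub, abs_mul]
        gcongr
        rw [inv_sub_inv (sub_ne_zero.2 (h3 i)) (sub_ne_zero.2 (h4 i)), abs_div, abs_mul,
          show hH.eigenvalues i - E' - (hH.eigenvalues i - E) = E - E' by ring]
        have hpos : 0 < δ * (δ / 2) := by positivity
        calc _ ≤ ε / (δ * (δ / 2)) := by
              have := abs_nonneg (E - E')
              gcongr
              exacts [by linarith, h1 i, h2 i]
          _ = _ := by field_simp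
    _ ≤ 1 * (2 * ε / δ ^ 2) := by
        rw [← Finset.sum_mul]
        have := (abs_nonneg (E - E')).trans hε
        gcongr
        exact sum_abs_eigenvector_le hH x y
    _ = _ := one_mul _

/-- Near an eigenvalue some entry of the resolvent is large. -/
theorem exists_le_abs_resolvent {H : Matrix ι ι ℝ} {E E' η : ℝ}
    (hE : (H - E • (1 : Matrix ι ι ℝ)).det ≠ 0) (hE' : (H - E' • (1 : Matrix ι ι ℝ)).det = 0)
    (hη : |E - E'| ≤ η) :
    ∃ x y, 1 ≤ η * Fintype.card ι * |(H - E • (1 : Matrix ι ι ℝ))⁻¹ x y| := by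
  obtain ⟨f, hf0, hf⟩ := Matrix.exists_mulVec_eq_zero_iff.2 hE'
  set G := (H - E • (1 : Matrix ι ι ℝ))⁻¹ with hG
  -- An eigenvector at `E'` is reproduced by `(E' - E) G`; evaluating where `|f|` is maximal bounds
  -- a row sum of `|G|` from below.
  have h1 : f = (E' - E) • Matrix.mulVec G f := by
    have h2 : Matrix.mulVec (H - E • (1 : Matrix ι ι ℝ)) f = (E' - E) • f := by
      rw [Matrix.sub_mulVec, Matrix.smul_mulVec, Matrix.one_mulVec] at hf ⊢
      rw [sub_eq_zero.1 hf, sub_smul]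
    rw [← Matrix.mulVec_smul, ← h2, Matrix.mulVec_mulVec, hG,
      Matrix.nonsing_inv_mul _ (isUnit_iff_ne_zero.2 hE), Matrix.one_mulVec]
  obtain ⟨x₀, hx₀⟩ := Function.ne_iff.1 hf0
  have hne : (Finset.univ : Finset ι).Nonempty := ⟨x₀, Finset.mem_univ _⟩
  obtain ⟨x, -, hx⟩ := Finset.exists_max_image Finset.univ (fun x => |f x|) hne
  have hfx : 0 < |f x| := lt_of_lt_of_le (abs_pos.2 hx₀) (hx x₀ (Finset.mem_univ _))
  have hη0 : 0 ≤ η := (abs_nonneg _).trans hη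
  have h3 : |f x| ≤ η * (∑ y, |G x y|) * |f x| := by
    conv_lhs => rw [h1]
    rw [Pi.smul_apply, smul_eq_mul, abs_mul, mul_assoc, abs_sub_comm]
    gcongr
    rw [Matrix.mulVec, dotProduct, Finset.sum_mul]
    refine (Finset.abs_sum_le_sum_abs _ _).trans (Finset.sum_le_sum fun y _ => ?_)
    rw [abs_mul]
    exact mul_le_mul_of_nonneg_left (hx y (Finset.mem_univ _)) (abs_nonneg _)
  have h4 : 1 ≤ η * ∑ y, |G x y| := by
    by_contra! h
    nlinarith
  obtain ⟨y, -, hy⟩ := Finset.exists_max_image Finset.univ (fun y => |G x y|) hne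
  refine ⟨x, y, h4.trans ?_⟩
  rw [mul_assoc]
  gcongr
  simpa using Finset.sum_le_card_nsmul Finset.univ (fun y => |G x y|) (|G x y|)
    fun z hz => hy z hz

end Spectral

/-! ### Probability estimates in finite volume. -/

section FiniteVolume

/-- The random matrix `T + g v`. -/
def potentialMatrix {ι : Type*} [DecidableEq ι] (T : Matrix ι ι ℝ) (g : ℝ) (v : ι → ℝ) :
    Matrix ι ι ℝ :=
  T + Matrix.diagonal fun x => g * v x

/-- The matrix `T + g v` with energy `E` subtracted from the diagonal. -/
def shiftedMatrix {ι : Type*} [DecidableEq ι] (T : Matrix ι ι ℝ) (g : ℝ) (v : ι → ℝ) (E : ℝ) :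
    Matrix ι ι ℝ :=
  potentialMatrix T g v - E • (1 : Matrix ι ι ℝ)

/-- Finite-volume hypotheses of strong disorder: the hopping matrix `T` has finite range for the
distance `D`, and the fractional moments of the single-site potential are small with respect
to it. -/
structure StrongDisorder {ι : Type*} [Fintype ι] [DecidableEq ι] (μ : Measure ℝ) (g s κ : ℝ)
    (T : Matrix ι ι ℝ) (D : ι → ι → ℝ) : Prop where
  s_pos : 0 < s
  s_le_one : s ≤ 1
  κ_nonneg : 0 ≤ κ
  isHermitian : T.IsHermitian
  dist_self : ∀ x, D x x ≤ 0
  dist_nonneg : ∀ x y, 0 ≤ D x y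
  dist_step : ∀ x z, z ≠ x → T x z ≠ 0 → ∀ y, D x y ≤ D z y + 1
  moment : ∃ K : ℝ≥0∞, K ≤ 1 ∧ (∀ c : ℝ, ∫⁻ t, ‖g * t - c‖ₑ ^ (-s) ∂μ ≤ K) ∧
    ∀ x, (∑ z ∈ Finset.univ.erase x, ‖T x z‖ₑ ^ s) * K ≤ ENNReal.ofReal (Real.exp (-κ))

variable {ι : Type*} [DecidableEq ι]

theorem continuous_shiftedMatrix (T : Matrix ι ι ℝ) (g : ℝ) :
    Continuous fun p : (ι → ℝ) × ℝ => shiftedMatrix T g p.1 p.2 := by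
  unfold shiftedMatrix potentialMatrix
  fun_prop

variable [Fintype ι]

theorem maskedMatrix_sub_univ (T : Matrix ι ι ℝ) (g : ℝ) (v : ι → ℝ) (E : ℝ) :
    maskedMatrix (T - E • (1 : Matrix ι ι ℝ)) g Finset.univ v = shiftedMatrix T g v E := by
  rw [maskedMatrix_univ, shiftedMatrix, potentialMatrix]
  abel

variable {μ : Measure ℝ} {g s κ : ℝ} {T : Matrix ι ι ℝ} {D : ι → ι → ℝ}

namespace StrongDisorder

theorem potentialMatrix_isHermitian (h : StrongDisorder μ g s κ T D) (v : ι → ℝ) :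
    (potentialMatrix T g v).IsHermitian :=
  h.isHermitian.add (Matrix.isHermitian_diagonal _)

variable [IsProbabilityMeasure μ]

theorem ae_det_ne_zero (h : StrongDisorder μ g s κ T D) (E : ℝ) :
    ∀ᵐ v ∂Measure.pi (fun _ : ι => μ), (shiftedMatrix T g v E).det ≠ 0 := by
  obtain ⟨K, hK1, hK, -⟩ := h.moment
  have := ae_det_maskedMatrix_ne_zero (ι := ι) h.s_pos (ne_top_of_le_ne_top ENNReal.one_ne_top hK1)
    hK (T - E • (1 : Matrix ι ι ℝ)) Finset.univ
  simpa only [maskedMatrix_sub_univ] using this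

/-- Markov's inequality for the fractional moment. Subtracting `E` changes only the diagonal of `T`,
which the hopping condition ignores, so the bound is uniform in `E`. -/
theorem measure_green_ge (h : StrongDisorder μ g s κ T D) (E : ℝ) (x y : ι) {a : ℝ} (ha : 0 < a) :
    Measure.pi (fun _ : ι => μ) {v | a ≤ |(shiftedMatrix T g v E)⁻¹ x y|} ≤
      ENNReal.ofReal (Real.exp (-κ * D x y) * (a⁻¹) ^ s) := by
  obtain ⟨K, hK1, hK, hT⟩ := h.moment
  have hoff : ∀ x z : ι, z ≠ x → (T - E • (1 : Matrix ι ι ℝ)) x z = T x z := fun x z hz => by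
    simp [Matrix.one_apply_ne hz.symm]
  have hFM := lintegral_green_le (ι := ι) h.s_pos h.s_le_one
    (ne_top_of_le_ne_top ENNReal.one_ne_top hK1) h.κ_nonneg hK (T := T - E • (1 : Matrix ι ι ℝ))
    h.dist_self
    (fun x z hz hne => h.dist_step x z hz (by rwa [hoff x z hz] at hne))
    (fun x => by
      rw [Finset.sum_congr rfl fun z hz => by rw [hoff x z (Finset.ne_of_mem_erase hz)]]
      exact hT x)
    Finset.univ x (Finset.mem_univ _) y (Finset.mem_univ _)
  simp only [maskedMatrix_sub_univ] at hFM
  have hm : Measurable fun v => ‖(shiftedMatrix T g v E)⁻¹ x y‖ₑ ^ s :=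
    (measurable_inv_apply ((continuous_shiftedMatrix T g).comp
      (Continuous.prodMk_left E)) x y).enorm.pow_const s
  have has : 0 < a ^ s := Real.rpow_pos_of_pos ha s
  calc _ ≤ Measure.pi (fun _ : ι => μ) {v | ENNReal.ofReal (a ^ s) ≤
          ‖(shiftedMatrix T g v E)⁻¹ x y‖ₑ ^ s} := by
        refine measure_mono fun v hv => ?_
        simp only [Set.mem_ofPred_eq] at hv ⊢
        rw [Real.enorm_eq_ofReal_abs, ENNReal.ofReal_rpow_of_nonneg (abs_nonneg _) h.s_pos.le]
        exact ENNReal.ofReal_le_ofReal (Real.rpow_le_rpow ha.le hv h.s_pos.le)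
    _ ≤ (∫⁻ v, ‖(shiftedMatrix T g v E)⁻¹ x y‖ₑ ^ s ∂Measure.pi (fun _ : ι => μ)) /
          ENNReal.ofReal (a ^ s) :=
        meas_ge_le_lintegral_div hm.aemeasurable (by simpa using has) ENNReal.ofReal_ne_top
    _ ≤ (1 * ENNReal.ofReal (Real.exp (-κ * D x y))) / ENNReal.ofReal (a ^ s) := by
        gcongr
        exact hFM.trans (by gcongr)
    _ = _ := by
        rw [one_mul, ← ENNReal.ofReal_div_of_pos has, Real.inv_rpow ha.le, div_eq_mul_inv]

/-- A Wegner-type estimate on the probability that a given energy is close to the spectrum. -/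
theorem measure_spectrum_near_le (h : StrongDisorder μ g s κ T D) (E : ℝ) {η : ℝ} (hη : 0 < η) :
    Measure.pi (fun _ : ι => μ) {v | ∃ E', |E - E'| ≤ η ∧ (shiftedMatrix T g v E').det = 0} ≤
      ENNReal.ofReal ((Fintype.card ι : ℝ) ^ 2 * (η * Fintype.card ι) ^ s) := by
  rcases isEmpty_or_nonempty ι with hι | hι
  · have : {v : ι → ℝ | ∃ E', |E - E'| ≤ η ∧ (shiftedMatrix T g v E').det = 0} = ∅ := by
      ext v; simp
    rw [this]; simp
  have hc : (0 : ℝ) < Fintype.card ι := by exact_mod_cast Fintype.card_pos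
  have hpos : 0 < η * Fintype.card ι := by positivity
  calc _ ≤ Measure.pi (fun _ : ι => μ) (⋃ p : ι × ι,
          {v | (η * Fintype.card ι)⁻¹ ≤ |(shiftedMatrix T g v E)⁻¹ p.1 p.2|}) := by
        refine measure_mono_ae ?_
        filter_upwards [h.ae_det_ne_zero E] with v hv
        rintro ⟨E', h1, h2⟩
        obtain ⟨x, y, hxy⟩ := exists_le_abs_resolvent hv h2 h1
        refine Set.mem_iUnion.2 ⟨(x, y), ?_⟩
        simp only [Set.mem_ofPred_eq]
        rw [inv_le_iff_one_le_mul₀' hpos]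
        exact hxy
    _ ≤ ∑ p : ι × ι, Measure.pi (fun _ : ι => μ)
          {v | (η * Fintype.card ι)⁻¹ ≤ |(shiftedMatrix T g v E)⁻¹ p.1 p.2|} :=
        measure_iUnion_fintype_le _ _
    _ ≤ ∑ p : ι × ι, ENNReal.ofReal ((η * Fintype.card ι) ^ s) := by
        refine Finset.sum_le_sum fun p _ => (h.measure_green_ge E p.1 p.2 (by positivity)).trans ?_
        refine ENNReal.ofReal_le_ofReal ?_
        -- Decay plays no role here: all pairs of sites are treated alike.
        rw [inv_inv]
        refine mul_le_of_le_one_left (by positivity) (Real.exp_le_one_iff.2 ?_)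
        nlinarith [h.dist_nonneg p.1 p.2, h.κ_nonneg]
    _ = _ := by
        rw [Finset.sum_const, Finset.card_univ, Fintype.card_prod, nsmul_eq_mul,
          ENNReal.ofReal_mul (by positivity)]
        congr 1
        rw [← sq, ← Nat.cast_pow, ENNReal.ofReal_natCast]

/-- With high probability, a large Green function at distance `L` forces the energy to be
exponentially close to the spectrum, uniformly in the energy. -/
theorem measure_exists_green_gt_le {m : ℝ} (h : StrongDisorder μ g s (2 * m + 3) T D)
    (hm : 0 ≤ m) (x : ι) {R L : ℝ} (hR : 0 ≤ R) (hL : 0 ≤ L) :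
    Measure.pi (fun _ : ι => μ) {v | ∃ E, |E| ≤ R ∧
      (∀ E₀, (shiftedMatrix T g v E₀).det = 0 → Real.exp (-L) ≤ |E - E₀|) ∧
      ∃ u, L ≤ D x u ∧ Real.exp (-m * L) < |(shiftedMatrix T g v E)⁻¹ x u|} ≤
      ENNReal.ofReal ((16 * R + 4) * Fintype.card ι * Real.exp (-L)) := by
  -- Grid spacing chosen so that, at distance `exp (-L)` from the spectrum, rounding the energy
  -- moves the resolvent by at most half of `exp (-m * L)`.
  set ε : ℝ := Real.exp (-(m + 2) * L) / 4 with hεdef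
  have hε : 0 < ε := by positivity
  have hεδ : ε ≤ Real.exp (-L) / 2 := by
    have : Real.exp (-(m + 2) * L) ≤ Real.exp (-L) := Real.exp_le_exp.2 (by nlinarith)
    have := Real.exp_pos (-L)
    linarith
  have hεδ2 : 2 * ε / Real.exp (-L) ^ 2 = Real.exp (-m * L) / 2 := by
    have : Real.exp (-(m + 2) * L) = Real.exp (-m * L) * Real.exp (-L) ^ 2 := by
      rw [← Real.exp_nat_mul, ← Real.exp_add]; congr 1; push_cast; ring
    rw [hεdef, this]
    field_simp
    norm_num
  set I : Finset ℤ := Finset.Icc ⌊-R / ε⌋ ⌊R / ε⌋ with hI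
  have hcard : (I.card : ℝ) ≤ (8 * R + 2) * Real.exp ((m + 2) * L) := by
    have h1 : ((I.card : ℤ) : ℝ) ≤ 2 * (R / ε) + 2 := by
      have hle : ⌊-R / ε⌋ ≤ ⌊R / ε⌋ + 1 := by
        have : ⌊-R / ε⌋ ≤ ⌊R / ε⌋ := Int.floor_le_floor (by gcongr; linarith)
        linarith
      rw [hI, Int.card_Icc_of_le _ _ hle]
      push_cast
      have h2 := Int.floor_le (R / ε)
      have h3 := Int.lt_floor_add_one (-R / ε)
      rw [neg_div] at h3 ⊢
      linarith
    have h2 : R / ε = 4 * R * Real.exp ((m + 2) * L) := by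
      rw [hεdef, neg_mul, Real.exp_neg]; field_simp
    have h3 : 1 ≤ Real.exp ((m + 2) * L) := Real.one_le_exp (by positivity)
    rw [h2] at h1
    push_cast at h1
    nlinarith
  have key : {v | ∃ E, |E| ≤ R ∧
      (∀ E₀, (shiftedMatrix T g v E₀).det = 0 → Real.exp (-L) ≤ |E - E₀|) ∧
      ∃ u, L ≤ D x u ∧ Real.exp (-m * L) < |(shiftedMatrix T g v E)⁻¹ x u|} ⊆
      ⋃ p ∈ I ×ˢ Finset.univ.filter (fun u => L ≤ D x u),
        {v | Real.exp (-m * L) / 2 ≤ |(shiftedMatrix T g v ((p.1 : ℝ) * ε))⁻¹ x p.2|} := by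
    rintro v ⟨E, hER, hspec, u, hu, hgreen⟩
    obtain ⟨hE1, hE2⟩ := abs_le.1 hER
    simp only [Set.mem_iUnion]
    refine ⟨(⌊E / ε⌋, u), ?_, ?_⟩
    · simp only [Finset.mem_product, Finset.mem_filter, Finset.mem_univ, true_and, hI,
        Finset.mem_Icc]
      exact ⟨⟨Int.floor_le_floor (by gcongr), Int.floor_le_floor (by gcongr)⟩, hu⟩
    · have hd : |E - (⌊E / ε⌋ : ℝ) * ε| ≤ ε := by
        have h1 := Int.floor_le (E / ε)
        have h2 := Int.lt_floor_add_one (E / ε)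
        rw [le_div_iff₀ hε] at h1
        rw [div_lt_iff₀ hε] at h2
        rw [abs_le]; constructor <;> linarith
      have h1 := abs_resolvent_sub_le (h.potentialMatrix_isHermitian v) (Real.exp_pos (-L)) hspec
        hd hεδ x u
      rw [hεδ2] at h1
      have h2 := abs_sub_abs_le_abs_sub
        ((shiftedMatrix T g v E)⁻¹ x u) ((shiftedMatrix T g v ((⌊E / ε⌋ : ℝ) * ε))⁻¹ x u)
      simp only [Set.mem_ofPred_eq]
      unfold shiftedMatrix at h2 hgreen ⊢
      linarith
  refine (measure_mono key).trans ((measure_biUnion_finset_le _ _).trans ?_)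
  have hterm : ∀ p ∈ I ×ˢ Finset.univ.filter (fun u => L ≤ D x u),
      Measure.pi (fun _ : ι => μ)
        {v | Real.exp (-m * L) / 2 ≤ |(shiftedMatrix T g v ((p.1 : ℝ) * ε))⁻¹ x p.2|} ≤
      ENNReal.ofReal (2 * Real.exp (-(m + 3) * L)) := by
    intro p hp
    simp only [Finset.mem_product, Finset.mem_filter, Finset.mem_univ, true_and] at hp
    refine (h.measure_green_ge _ x p.2 (by positivity)).trans (ENNReal.ofReal_le_ofReal ?_)
    have h1 : (Real.exp (-m * L) / 2)⁻¹ = 2 * Real.exp (m * L) := by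
      rw [neg_mul, Real.exp_neg]; field_simp
    have h2 : 1 ≤ 2 * Real.exp (m * L) := by
      have : 1 ≤ Real.exp (m * L) := Real.one_le_exp (by positivity)
      linarith
    rw [h1]
    -- The rate `2m + 3` pays `m` for the threshold and `m + 2` for the number of grid points,
    -- leaving `exp (-L)`.
    calc _ ≤ Real.exp (-(2 * m + 3) * L) * (2 * Real.exp (m * L)) := by
          refine mul_le_mul (Real.exp_le_exp.2 ?_) ?_ (by positivity) (by positivity)
          · nlinarith [hp.2]
          · calc _ ≤ (2 * Real.exp (m * L)) ^ (1 : ℝ) :=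
                Real.rpow_le_rpow_of_exponent_le h2 h.s_le_one
              _ = _ := Real.rpow_one _
      _ = _ := by
          rw [mul_left_comm, ← Real.exp_add]; congr 2; ring
  refine (Finset.sum_le_card_nsmul _ _ _ hterm).trans ?_
  rw [nsmul_eq_mul, ← ENNReal.ofReal_natCast, ← ENNReal.ofReal_mul (by positivity),
    Finset.card_product]
  refine ENNReal.ofReal_le_ofReal ?_
  have hf : ((Finset.univ.filter (fun u => L ≤ D x u)).card : ℝ) ≤ Fintype.card ι := by
    exact_mod_cast Finset.card_le_univ _
  push_cast
  calc _ ≤ (8 * R + 2) * Real.exp ((m + 2) * L) * Fintype.card ι *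
        (2 * Real.exp (-(m + 3) * L)) := by gcongr
    _ = (16 * R + 4) * Fintype.card ι *
        (Real.exp ((m + 2) * L) * Real.exp (-(m + 3) * L)) := by ring
    _ = _ := by rw [← Real.exp_add]; congr 2; ring

end StrongDisorder

/-- Two independent boxes are unlikely to have close eigenvalues. -/
theorem measure_spectra_near_le [IsProbabilityMeasure μ] {ι' : Type*} [Fintype ι'] [DecidableEq ι'] {T' : Matrix ι' ι' ℝ}
    {D' : ι' → ι' → ℝ} (h : StrongDisorder μ g s κ T D) (h' : StrongDisorder μ g s κ T' D')
    (R : ℝ) {η : ℝ} (hη : 0 < η) :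
    ((Measure.pi fun _ : ι => μ).prod (Measure.pi fun _ : ι' => μ)) {p | ∃ E E', |E| ≤ R ∧
      |E - E'| ≤ η ∧ (shiftedMatrix T g p.1 E).det = 0 ∧ (shiftedMatrix T' g p.2 E').det = 0} ≤
    ENNReal.ofReal (Fintype.card ι *
      ((Fintype.card ι' : ℝ) ^ 2 * (η * Fintype.card ι') ^ s)) := by
  set W : Set ((ι → ℝ) × (ι' → ℝ)) := {p | ∃ E E', |E| ≤ R ∧
      |E - E'| ≤ η ∧ (shiftedMatrix T g p.1 E).det = 0 ∧ (shiftedMatrix T' g p.2 E').det = 0}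
  -- Fubini needs measurability: `W` is the projection of a closed set along a compact square of
  -- energies, which is why energies are bounded by `R`.
  have hW : MeasurableSet W := by
    set C : Set (((Set.Icc (-R) R ×ˢ Set.Icc (-(R + η)) (R + η) : Set (ℝ × ℝ))) ×
        ((ι → ℝ) × (ι' → ℝ))) := {q | |q.1.1.1 - q.1.1.2| ≤ η ∧
        (shiftedMatrix T g q.2.1 q.1.1.1).det = 0 ∧
        (shiftedMatrix T' g q.2.2 q.1.1.2).det = 0} with hC
    have hc : IsClosed C := by
      have h1 : IsClosed {q : ((Set.Icc (-R) R ×ˢ Set.Icc (-(R + η)) (R + η) : Set (ℝ × ℝ))) ×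
        ((ι → ℝ) × (ι' → ℝ)) | |q.1.1.1 - q.1.1.2| ≤ η} :=
        isClosed_le (by fun_prop) continuous_const
      refine h1.inter
        ((isClosed_eq ?_ continuous_const).inter (isClosed_eq ?_ continuous_const))
      · exact ((continuous_shiftedMatrix T g).comp (f := fun q : (Set.Icc (-R) R ×ˢ
          Set.Icc (-(R + η)) (R + η) : Set (ℝ × ℝ)) × ((ι → ℝ) × (ι' → ℝ)) =>
          (q.2.1, q.1.1.1)) (by fun_prop)).matrix_det
      · exact ((continuous_shiftedMatrix T' g).comp (f := fun q : (Set.Icc (-R) R ×ˢ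
          Set.Icc (-(R + η)) (R + η) : Set (ℝ × ℝ)) × ((ι → ℝ) × (ι' → ℝ)) =>
          (q.2.2, q.1.1.2)) (by fun_prop)).matrix_det
    have : CompactSpace (Set.Icc (-R) R ×ˢ Set.Icc (-(R + η)) (R + η) : Set (ℝ × ℝ)) :=
      isCompact_iff_compactSpace.1 (isCompact_Icc.prod isCompact_Icc)
    have hcl := isClosedMap_snd_of_compactSpace _ hc
    convert hcl.measurableSet using 1
    ext p
    constructor
    · rintro ⟨E, E', h1, h2, h3, h4⟩
      have h1' := abs_le.1 h1
      have h2' := abs_le.1 h2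
      exact ⟨(⟨(E, E'), h1', ⟨by linarith, by linarith⟩⟩, p), ⟨h2, h3, h4⟩, rfl⟩
    · rintro ⟨⟨⟨⟨E, E'⟩, hE, _⟩, p'⟩, hq, rfl⟩
      rw [hC] at hq
      obtain ⟨h2, h3, h4⟩ := hq
      exact ⟨E, E', abs_le.2 hE, h2, h3, h4⟩
  rw [Measure.prod_apply hW]
  calc _ ≤ ∫⁻ _, ENNReal.ofReal (Fintype.card ι *
        ((Fintype.card ι' : ℝ) ^ 2 * (η * Fintype.card ι') ^ s)) ∂(Measure.pi fun _ : ι => μ) := by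
        refine lintegral_mono fun v => ?_
        -- With the first potential frozen, its eigenvalues are finitely many fixed energies for the
        -- Wegner bound in the second box.
        set lam := (h.potentialMatrix_isHermitian v).eigenvalues
        calc _ ≤ (Measure.pi fun _ : ι' => μ) (⋃ i, {v' | ∃ E', |lam i - E'| ≤ η ∧
                (shiftedMatrix T' g v' E').det = 0}) := by
              refine measure_mono ?_
              rintro v' ⟨E, E', h1, h2, h3, h4⟩
              obtain ⟨i, hi⟩ := exists_eigenvalues_eq_of_det_eq_zero
                (h.potentialMatrix_isHermitian v) h3
              refine Set.mem_iUnion.2 ⟨i, E', ?_, h4⟩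
              rwa [show lam i = E from hi]
          _ ≤ ∑ i, (Measure.pi fun _ : ι' => μ) {v' | ∃ E', |lam i - E'| ≤ η ∧
                (shiftedMatrix T' g v' E').det = 0} := measure_iUnion_fintype_le _ _
          _ ≤ ∑ _i : ι, ENNReal.ofReal ((Fintype.card ι' : ℝ) ^ 2 * (η * Fintype.card ι') ^ s) :=
              Finset.sum_le_sum fun i _ => h'.measure_spectrum_near_le _ hη
          _ = _ := by
              rw [Finset.sum_const, Finset.card_univ, nsmul_eq_mul,
                ENNReal.ofReal_mul (p := (Fintype.card ι : ℝ)) (by positivity),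
                ENNReal.ofReal_natCast]
    _ = _ := by simp

end FiniteVolume

/-! ### Boxes in the lattice and simultaneous singularity. -/

section Lattice

variable {d : ℕ}

/-- The coordinates are integers. -/
theorem add_one_le_norm_of_lt {w : Lattice d} {L : ℕ} (h : (L : ℝ) < ‖w‖) : (L : ℝ) + 1 ≤ ‖w‖ := by
  by_contra! hlt
  refine h.not_ge ((pi_norm_le_iff_of_nonneg (Nat.cast_nonneg L)).2 fun i => ?_)
  have h1 := (norm_le_pi_norm w i).trans_lt hlt
  rw [Int.norm_eq_abs] at h1 ⊢
  have h2 : |w i| < L + 1 := by exact_mod_cast h1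
  exact_mod_cast Int.lt_add_one_iff.1 h2

/-- The cube of radius `L` in the max-norm. -/
noncomputable def box (x : Lattice d) (L : ℕ) : Finset (Lattice d) :=
  Finset.Icc (x - fun _ => (L : ℤ)) (x + fun _ => (L : ℤ))

theorem mem_box {x y : Lattice d} {L : ℕ} : y ∈ box x L ↔ ‖x - y‖ ≤ L := by
  rw [box, Finset.mem_Icc, pi_norm_le_iff_of_nonneg (Nat.cast_nonneg L), Pi.le_def, Pi.le_def,
    ← forall_and]
  refine forall_congr' fun i => ?_
  simp only [Pi.sub_apply, Pi.add_apply, Int.norm_eq_abs]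
  have : |((x i - y i : ℤ) : ℝ)| ≤ L ↔ |x i - y i| ≤ (L : ℤ) := by exact_mod_cast Iff.rfl
  rw [this, abs_le]
  constructor <;> rintro ⟨h1, h2⟩ <;> constructor <;> linarith

theorem self_mem_box (x : Lattice d) (L : ℕ) : x ∈ box x L := by simp [mem_box]

theorem card_box (x : Lattice d) (L : ℕ) : (box x L).card = (2 * L + 1) ^ d := by
  rw [box, Pi.card_Icc]
  simp only [Pi.sub_apply, Pi.add_apply, Int.card_Icc]
  rw [Finset.prod_congr rfl (g := fun _ => 2 * L + 1) (fun i _ => by omega)]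
  simp

theorem disjoint_box {x y : Lattice d} {L : ℕ} (h : 2 * (L : ℝ) < ‖x - y‖) :
    Disjoint (box x L) (box y L) := by
  refine Finset.disjoint_left.2 fun z hx hy => ?_
  rw [mem_box] at hx hy
  have := norm_sub_le_norm_sub_add_norm_sub x z y
  rw [norm_sub_rev z y] at this
  linarith

/-- The kernel of `-Δ`. -/
noncomputable def hopping (x z : Lattice d) : ℝ :=
  (if z = x then 2 * (d : ℝ) else 0) - ∑ j : Fin d,
    ((if z = x + Pi.single j 1 then 1 else 0) + (if z = x - Pi.single j 1 then 1 else 0))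

theorem hopping_comm (x z : Lattice d) : hopping x z = hopping z x := by
  unfold hopping
  have h1 : ∀ j : Fin d, z = x + Pi.single j 1 ↔ x = z - Pi.single j 1 := fun j =>
    ⟨fun h => by rw [h, add_sub_cancel_right], fun h => by rw [h, sub_add_cancel]⟩
  have h2 : ∀ j : Fin d, z = x - Pi.single j 1 ↔ x = z + Pi.single j 1 := fun j =>
    ⟨fun h => by rw [h, sub_add_cancel], fun h => by rw [h, add_sub_cancel_right]⟩
  simp only [h1, h2, eq_comm (a := z) (b := x)]
  congr 1
  exact Finset.sum_congr rfl fun j _ => add_comm _ _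

theorem norm_sub_le_of_hopping_ne_zero {x z : Lattice d} (hzx : z ≠ x) (h : hopping x z ≠ 0)
    (y : Lattice d) : ‖x - y‖ ≤ ‖z - y‖ + 1 := by
  have h1 : ‖x - z‖ ≤ 1 := by
    unfold hopping at h
    rw [if_neg hzx, zero_sub, neg_ne_zero] at h
    obtain ⟨j, -, hj⟩ := Finset.exists_ne_zero_of_sum_ne_zero h
    by_cases hp : z = x + Pi.single j 1
    · rw [hp, sub_add_cancel_left, norm_neg, Pi.norm_single]; simp
    · by_cases hq : z = x - Pi.single j 1
      · rw [hq, sub_sub_cancel, Pi.norm_single]; simp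
      · simp [hp, hq] at hj
  have := norm_sub_le_norm_sub_add_norm_sub x z y
  linarith

theorem sum_enorm_hopping_le {s : ℝ} (hs : 0 < s) (hs1 : s ≤ 1) (A : Finset (Lattice d))
    (x : Lattice d) : ∑ z ∈ A.erase x, ‖hopping x z‖ₑ ^ s ≤ 2 * d := by
  have hite : ∀ p : Prop, [Decidable p] → ‖(if p then 1 else 0 : ℝ)‖ₑ ^ s = if p then 1 else 0 := by
    intro p _
    by_cases h : p <;> simp [h, hs]
  have h1 : ∀ z ∈ A.erase x, ‖hopping x z‖ₑ ^ s ≤ ∑ j : Fin d,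
      ((if z = x + Pi.single j 1 then 1 else 0) + (if z = x - Pi.single j 1 then 1 else 0)) := by
    intro z hz
    rw [hopping, if_neg (Finset.ne_of_mem_erase hz), zero_sub, enorm_neg]
    refine (enorm_sum_rpow_le _ _ hs hs1).trans (Finset.sum_le_sum fun j _ => ?_)
    refine (ENNReal.rpow_le_rpow (enorm_add_le _ _) hs.le).trans
      ((ENNReal.rpow_add_le_add_rpow _ _ hs.le hs1).trans ?_)
    rw [hite, hite]
  refine (Finset.sum_le_sum h1).trans ?_
  rw [Finset.sum_comm]
  calc _ ≤ ∑ _j : Fin d, (2 : ℝ≥0∞) := by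
        refine Finset.sum_le_sum fun j _ => ?_
        rw [Finset.sum_add_distrib, Finset.sum_ite_eq', Finset.sum_ite_eq', ← one_add_one_eq_two]
        gcongr <;> split_ifs <;> simp
    _ = _ := by simp [mul_comm]

/-- The kernel of `-Δ` restricted to a finite set. -/
noncomputable def boxHopping (A : Finset (Lattice d)) : Matrix A A ℝ := fun x z => hopping x.1 z.1

/-- At most `2d` hops leave a site, each with entry of modulus at most one. The denominator `2d + 1`
secures both the hopping bound and `K ≤ 1`, including for `d = 0`. -/
theorem strongDisorder_boxHopping {μ : Measure ℝ} {g s κ : ℝ} (hs : 0 < s) (hs1 : s ≤ 1)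
    (hκ : 0 ≤ κ) (hμ : ∀ c : ℝ, ∫⁻ t, ‖g * t - c‖ₑ ^ (-s) ∂μ ≤
      ENNReal.ofReal (Real.exp (-κ) / (2 * d + 1))) (A : Finset (Lattice d)) :
    StrongDisorder μ g s κ (boxHopping A) (fun x y => ‖x.1 - y.1‖) where
  s_pos := hs
  s_le_one := hs1
  κ_nonneg := hκ
  isHermitian := by
    ext x z
    simp [boxHopping, hopping_comm z.1 x.1]
  dist_self x := by simp
  dist_nonneg x y := norm_nonneg _
  dist_step x z hz h y := norm_sub_le_of_hopping_ne_zero (fun e => hz (Subtype.ext e)) h y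
  moment := by
    refine ⟨ENNReal.ofReal (Real.exp (-κ) / (2 * d + 1)), ?_, hμ, fun x => ?_⟩
    · rw [ENNReal.ofReal_le_one, div_le_one (by positivity)]
      have : Real.exp (-κ) ≤ 1 := Real.exp_le_one_iff.2 (by linarith)
      have : (0 : ℝ) ≤ d := Nat.cast_nonneg d
      linarith
    · have h1 : ∑ z ∈ Finset.univ.erase x, ‖boxHopping A x z‖ₑ ^ s ≤ 2 * d := by
        refine le_trans (le_of_eq ?_) (sum_enorm_hopping_le hs hs1 A x.1)
        refine Finset.sum_bij (fun z _ => z.1) (fun z hz => ?_) (fun z _ w _ h => Subtype.ext h)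
          (fun z hz => ?_) (fun z _ => rfl)
        · exact Finset.mem_erase.2
            ⟨fun e => Finset.ne_of_mem_erase hz (Subtype.ext e), z.2⟩
        · refine ⟨⟨z, Finset.mem_of_mem_erase hz⟩, Finset.mem_erase.2 ⟨fun e => ?_,
            Finset.mem_univ _⟩, rfl⟩
          exact Finset.ne_of_mem_erase hz (congrArg Subtype.val e)
      calc _ ≤ ENNReal.ofReal (2 * d) * ENNReal.ofReal (Real.exp (-κ) / (2 * d + 1)) := by
            gcongr
            refine h1.trans (le_of_eq ?_)
            rw [ENNReal.ofReal_mul (by norm_num)]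
            simp
        _ ≤ _ := by
            rw [← ENNReal.ofReal_mul (by positivity)]
            refine ENNReal.ofReal_le_ofReal ?_
            rw [← mul_div_assoc, div_le_iff₀ (by positivity)]
            nlinarith [Real.exp_pos (-κ)]

/-- The cube of radius `L` around `x` is singular at energy `E`: either `E` is an eigenvalue, or
the Green function from the centre to the boundary is not exponentially small. -/
def Singular (m g : ℝ) (v : Lattice d → ℝ) (E : ℝ) (x : Lattice d) (L : ℕ) : Prop :=
  (shiftedMatrix (boxHopping (box x L)) g (fun i => v i) E).det = 0 ∨
    ∃ u : box x L, (L : ℝ) ≤ ‖x - u.1‖ ∧ Real.exp (-m * L) <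
      |(shiftedMatrix (boxHopping (box x L)) g (fun i => v i) E)⁻¹ ⟨x, self_mem_box x L⟩ u|

section Probability

variable {Ω : Type*} [MeasurableSpace Ω] {P : Measure Ω} [IsProbabilityMeasure P]
  {V : Lattice d → Ω → ℝ}

theorem map_restrict_eq_pi (hV_meas : ∀ x, Measurable (V x)) (hV_indep : iIndepFun V P)
    (hV_ident : ∀ x, IdentDistrib (V x) (V 0) P P) (A : Finset (Lattice d)) :
    P.map (fun ω (i : A) => V i.1 ω) = Measure.pi fun _ : A => P.map (V 0) := by
  rw [(iIndepFun_iff_map_fun_eq_pi_map (f := fun (i : A) => V i.1)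
    (fun i => (hV_meas i.1).aemeasurable)).1 (hV_indep.precomp Subtype.val_injective)]
  congr 1
  funext i
  exact (hV_ident i.1).map_eq

theorem map_restrict_prod_eq (hV_meas : ∀ x, Measurable (V x)) (hV_indep : iIndepFun V P)
    (hV_ident : ∀ x, IdentDistrib (V x) (V 0) P P) {A B : Finset (Lattice d)}
    (hAB : Disjoint A B) :
    P.map (fun ω => (fun (i : A) => V i.1 ω, fun (i : B) => V i.1 ω)) =
      (Measure.pi fun _ : A => P.map (V 0)).prod (Measure.pi fun _ : B => P.map (V 0)) := by
  have h := hV_indep.indepFun_finset A B hAB hV_meas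
  have hm : ∀ A : Finset (Lattice d), AEMeasurable (fun ω (i : A) => V i.1 ω) P := fun A =>
    (measurable_pi_iff.2 fun i : A => hV_meas i.1).aemeasurable
  rw [indepFun_iff_map_prod_eq_prod_map_map (hm A) (hm B)] at h
  rw [h, map_restrict_eq_pi hV_meas hV_indep hV_ident,
    map_restrict_eq_pi hV_meas hV_indep hV_ident]

theorem measure_exists_green_box_gt_le (hV_meas : ∀ x, Measurable (V x))
    (hV_indep : iIndepFun V P) (hV_ident : ∀ x, IdentDistrib (V x) (V 0) P P) {m g s R : ℝ}
    (h : ∀ A : Finset (Lattice d), StrongDisorder (P.map (V 0)) g s (2 * m + 3) (boxHopping A)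
      (fun x y => ‖x.1 - y.1‖)) (hm : 0 ≤ m) (hR : 0 ≤ R) (x : Lattice d) (L : ℕ) :
    P {ω | ∃ E, |E| ≤ R ∧
      (∀ E₀, (shiftedMatrix (boxHopping (box x L)) g (fun i => V i.1 ω) E₀).det = 0 →
        Real.exp (-(L : ℝ)) ≤ |E - E₀|) ∧ Singular m g (fun i => V i ω) E x L} ≤
      ENNReal.ofReal ((16 * R + 4) * (2 * L + 1) ^ d * Real.exp (-(L : ℝ))) := by
  have : IsProbabilityMeasure (P.map (V 0)) :=
    Measure.isProbabilityMeasure_map (hV_meas 0).aemeasurable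
  have h1 := (h (box x L)).measure_exists_green_gt_le hm ⟨x, self_mem_box x L⟩ hR
    (Nat.cast_nonneg L)
  rw [← map_restrict_eq_pi hV_meas hV_indep hV_ident, Fintype.card_coe, card_box] at h1
  push_cast at h1
  -- This inequality holds for arbitrary sets, so the event need not be measurable.
  refine le_trans (le_trans (measure_mono ?_) (Measure.le_map_apply
    (measurable_pi_iff.2 fun i : box x L => hV_meas i.1).aemeasurable _)) h1
  rintro ω ⟨E, hER, hspec, hsing⟩
  refine ⟨E, hER, hspec, ?_⟩
  rcases hsing with h0 | hsing
  · have := hspec E h0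
    rw [sub_self, abs_zero] at this
    exact absurd this (not_le.2 (Real.exp_pos _))
  · exact hsing

/-- Two disjoint cubes are unlikely to be singular at a common energy. -/
theorem measure_exists_singular_le (hV_meas : ∀ x, Measurable (V x))
    (hV_indep : iIndepFun V P) (hV_ident : ∀ x, IdentDistrib (V x) (V 0) P P) {m g s R : ℝ}
    (h : ∀ A : Finset (Lattice d), StrongDisorder (P.map (V 0)) g s (2 * m + 3) (boxHopping A)
      (fun x y => ‖x.1 - y.1‖)) (hm : 0 ≤ m) (hR : 0 ≤ R) {x y : Lattice d} {L : ℕ}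
    (hxy : 2 * (L : ℝ) < ‖x - y‖) :
    P {ω | ∃ E, |E| ≤ R ∧ Singular m g (fun i => V i ω) E x L ∧
      Singular m g (fun i => V i ω) E y L} ≤
      ENNReal.ofReal ((32 * R + 10) * (2 * L + 1) ^ (4 * d) * Real.exp (-s * L)) := by
  have : IsProbabilityMeasure (P.map (V 0)) :=
    Measure.isProbabilityMeasure_map (hV_meas 0).aemeasurable
  have hs := (h ∅).s_pos
  have hs1 := (h ∅).s_le_one
  have hx := measure_exists_green_box_gt_le hV_meas hV_indep hV_ident h hm hR x L
  have hy := measure_exists_green_box_gt_le hV_meas hV_indep hV_ident h hm hR y L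
  -- If `E` is within `exp (-L)` of both spectra, these are within `2 * exp (-L)` of each other,
  -- near an eigenvalue of modulus at most `R + 1`. Otherwise `E` is far from one spectrum, and
  -- singularity of that box is rare.
  have hW := measure_spectra_near_le (h (box x L)) (h (box y L)) (R + 1)
    (η := 2 * Real.exp (-(L : ℝ))) (by positivity)
  rw [← map_restrict_prod_eq hV_meas hV_indep hV_ident (disjoint_box hxy), Fintype.card_coe,
    Fintype.card_coe, card_box, card_box] at hW
  push_cast at hW
  have hW' := (Measure.le_map_apply ((measurable_pi_iff.2 fun i : box x L => hV_meas i.1).prodMk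
    (measurable_pi_iff.2 fun i : box y L => hV_meas i.1)).aemeasurable _).trans hW
  refine (measure_mono ?_).trans ((measure_union_le _ _).trans
    (add_le_add ((measure_union_le _ _).trans (add_le_add hx hy)) hW')) |>.trans ?_
  · rintro ω ⟨E, hER, hsx, hsy⟩
    by_cases h1 : ∀ E₀, (shiftedMatrix (boxHopping (box x L)) g (fun i => V i.1 ω) E₀).det = 0 →
        Real.exp (-(L : ℝ)) ≤ |E - E₀|
    · exact Or.inl (Or.inl ⟨E, hER, h1, hsx⟩)
    by_cases h2 : ∀ E₀, (shiftedMatrix (boxHopping (box y L)) g (fun i => V i.1 ω) E₀).det = 0 →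
        Real.exp (-(L : ℝ)) ≤ |E - E₀|
    · exact Or.inl (Or.inr ⟨E, hER, h2, hsy⟩)
    push Not at h1 h2
    obtain ⟨E₁, h1, h1'⟩ := h1
    obtain ⟨E₂, h2, h2'⟩ := h2
    refine Or.inr ⟨E₁, E₂, ?_, ?_, h1, h2⟩
    · have h3 : Real.exp (-(L : ℝ)) ≤ 1 := Real.exp_le_one_iff.2 (by simp)
      have h4 := abs_sub_abs_le_abs_sub E₁ E
      rw [abs_sub_comm] at h4
      linarith
    · have h4 := abs_sub_le E₁ E E₂
      rw [abs_sub_comm E₁ E] at h4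
      linarith
  · rw [← ENNReal.ofReal_add (by positivity) (by positivity),
      ← ENNReal.ofReal_add (by positivity) (by positivity)]
    refine ENNReal.ofReal_le_ofReal ?_
    set n : ℝ := (2 * (L : ℝ) + 1) ^ d with hn
    have hn1 : 1 ≤ n := one_le_pow₀ (by linarith [(Nat.cast_nonneg L : (0 : ℝ) ≤ L)])
    have hn4 : (2 * (L : ℝ) + 1) ^ (4 * d) = n ^ 4 := by rw [hn, ← pow_mul, mul_comm d]
    have he : Real.exp (-(L : ℝ)) ≤ Real.exp (-s * L) :=
      Real.exp_le_exp.2 (by nlinarith [(Nat.cast_nonneg L : (0 : ℝ) ≤ L)])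
    have hr : (2 * Real.exp (-(L : ℝ)) * n) ^ s ≤ 2 * n * Real.exp (-s * L) := by
      rw [show 2 * Real.exp (-(L : ℝ)) * n = 2 * n * Real.exp (-(L : ℝ)) by ring,
        Real.mul_rpow (by positivity) (by positivity), ← Real.exp_mul,
        show -(L : ℝ) * s = -s * L by ring]
      gcongr
      calc (2 * n) ^ s ≤ (2 * n) ^ (1 : ℝ) := Real.rpow_le_rpow_of_exponent_le (by linarith) hs1
        _ = _ := Real.rpow_one _
    have hnn : n ≤ n ^ 4 := le_self_pow₀ hn1 (by norm_num)
    rw [hn4]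
    calc _ ≤ (16 * R + 4) * n ^ 4 * Real.exp (-s * L) + (16 * R + 4) * n ^ 4 * Real.exp (-s * L) +
          n * (n ^ 2 * (2 * n * Real.exp (-s * L))) := by gcongr
      _ = _ := by ring

end Probability

end Lattice

/-! ### Real eigenvalues and the Poisson formula. -/

section Eigenfunctions

variable {d : ℕ}

theorem summable_comp_add {f : Lattice d → ℝ} (hf : Summable f) (e : Lattice d) :
    Summable fun x => f (x + e) :=
  hf.comp_injective (add_left_injective e)

theorem summable_comp_sub {f : Lattice d → ℝ} (hf : Summable f) (e : Lattice d) :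
    Summable fun x => f (x - e) :=
  hf.comp_injective sub_left_injective

theorem tsum_comp_sub (f : Lattice d → ℝ) (e : Lattice d) : ∑' x, f (x - e) = ∑' x, f x :=
  (Equiv.subRight e).tsum_eq f

/-- Current conservation: `E.im * ‖ψ x‖ ^ 2` is the divergence of the summable current `Im (conj (ψ
x) * ψ (x + e_j))`, whose sum over the lattice vanishes. Self-adjointness of the unbounded operator
is not needed. -/
theorem eigenvalue_im_eq_zero {g : ℝ} {v : Lattice d → ℝ} {E : ℂ} {ψ : Lattice d → ℂ}
    (hψ : ψ ≠ 0) (hsq : Summable fun x => ‖ψ x‖ ^ 2)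
    (h : ∀ x, formalHamiltonian g v ψ x = E * ψ x) : E.im = 0 := by
  set a : Fin d → Lattice d → ℝ := fun j x =>
    ((starRingEnd ℂ) (ψ x) * ψ (x + Pi.single j 1)).im with ha
  have hsa : ∀ j, Summable (a j) := fun j => by
    have hshift := summable_comp_add hsq (Pi.single j 1)
    refine Summable.of_norm_bounded (hsq.add hshift) fun x => ?_
    refine (Complex.abs_im_le_norm _).trans ?_
    rw [norm_mul, RCLike.norm_conj]
    nlinarith [sq_nonneg (‖ψ x‖ - ‖ψ (x + Pi.single j 1)‖), sq_nonneg ‖ψ x‖,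
      sq_nonneg ‖ψ (x + Pi.single j 1)‖]
  have hpt : ∀ x, E.im * ‖ψ x‖ ^ 2 = ∑ j, (a j (x - Pi.single j 1) - a j x) := by
    intro x
    have h1 := congrArg (fun w => ((starRingEnd ℂ) (ψ x) * w).im) (h x)
    have h2 : ((starRingEnd ℂ) (ψ x) * (E * ψ x)).im = E.im * ‖ψ x‖ ^ 2 := by
      rw [mul_left_comm, mul_comm _ (ψ x), Complex.mul_conj, Complex.normSq_eq_norm_sq,
        Complex.im_mul_ofReal]
    have h3 : ((starRingEnd ℂ) (ψ x) * ((g : ℂ) * (v x : ℂ) * ψ x)).im = 0 := by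
      rw [mul_left_comm, mul_comm _ (ψ x), Complex.mul_conj, ← Complex.ofReal_mul,
        ← Complex.ofReal_mul, Complex.ofReal_im]
    have h4 : ∀ j, ((starRingEnd ℂ) (ψ x) * (ψ (x + Pi.single j 1) + ψ (x - Pi.single j 1) -
        2 * ψ x)).im = a j x - a j (x - Pi.single j 1) := by
      intro j
      have h5 : ((starRingEnd ℂ) (ψ x) * (2 * ψ x)).im = 0 := by
        rw [mul_left_comm, mul_comm _ (ψ x), Complex.mul_conj, Complex.im_mul_ofReal]
        simp
      have h6 : ((starRingEnd ℂ) (ψ x) * ψ (x - Pi.single j 1)).im =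
          -a j (x - Pi.single j 1) := by
        simp only [ha, sub_add_cancel]
        rw [← Complex.conj_im, map_mul, Complex.conj_conj, mul_comm]
      rw [mul_sub, mul_add, Complex.sub_im, Complex.add_im, h5, h6]
      simp only [ha]; ring
    simp only [h2] at h1
    rw [← h1]
    change ((starRingEnd ℂ) (ψ x) * (-laplacian ψ x +
      (g : ℂ) * (v x : ℂ) * ψ x)).im = _
    rw [mul_add, Complex.add_im, h3, add_zero, mul_neg, Complex.neg_im, laplacian, Finset.mul_sum,
      Complex.im_sum, ← Finset.sum_neg_distrib]
    exact Finset.sum_congr rfl fun j _ => by rw [h4]; ring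
  have hsum : ∑' x, E.im * ‖ψ x‖ ^ 2 = 0 := by
    simp only [hpt]
    have hsa' := fun j => summable_comp_sub (hsa j) (Pi.single j 1)
    rw [Summable.tsum_finsetSum fun j _ => (hsa' j).sub (hsa j)]
    refine Finset.sum_eq_zero fun j _ => ?_
    rw [(hsa' j).tsum_sub (hsa j),
      tsum_comp_sub, sub_self]
  rw [tsum_mul_left] at hsum
  refine (mul_eq_zero.1 hsum).resolve_right fun h0 => hψ ?_
  funext x
  have := (hsq.hasSum_iff.2 h0)
  rw [hasSum_zero_iff_of_nonneg fun x => by positivity] at this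
  have := congrFun this x
  simpa using this

/-- The Poisson-type formula: an eigenfunction is small at the centre of a nonsingular cube. -/
theorem norm_le_of_not_singular {m g E : ℝ} {v : Lattice d → ℝ} {ψ : Lattice d → ℂ}
    (hψ : ∀ x, ‖ψ x‖ ≤ 1) (h : ∀ x, formalHamiltonian g v ψ x = (E : ℂ) * ψ x)
    {y : Lattice d} {L : ℕ} (hns : ¬ Singular m g v E y L) :
    ‖ψ y‖ ≤ (2 * L + 1) ^ d * (2 * d * Real.exp (-m * L)) := by
  unfold Singular at hns
  push Not at hns
  obtain ⟨hdet, hG⟩ := hns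
  set A := box y L with hA
  set M := shiftedMatrix (boxHopping A) g (fun i => v i) E with hM
  -- The boundary source: on `A`, the restricted operator applied to `ψ` misses exactly the
  -- neighbours outside `A`.
  set r : A → ℂ := fun x => ∑ j : Fin d,
    ((if x.1 + Pi.single j 1 ∈ A then 0 else ψ (x.1 + Pi.single j 1)) +
      (if x.1 - Pi.single j 1 ∈ A then 0 else ψ (x.1 - Pi.single j 1))) with hr
  have hMr : ∀ x : A, ∑ z : A, ((M x z : ℝ) : ℂ) * ψ z = r x := by
    intro x
    have h1 : ∀ z : A, ((M x z : ℝ) : ℂ) * ψ z =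
        (hopping x.1 z.1 : ℂ) * ψ z + if x = z then ((g : ℂ) * v x - E) * ψ z else 0 := by
      intro z
      simp only [hM, shiftedMatrix, potentialMatrix, boxHopping, Matrix.sub_apply,
        Matrix.add_apply, Matrix.smul_apply, Matrix.diagonal_apply, Matrix.one_apply]
      by_cases hxz : x = z
      · subst hxz; simp; ring
      · simp [hxz]
    have hind : ∀ w : Lattice d, ∑ z ∈ A, (if z = w then (1 : ℂ) else 0) * ψ z =
        if w ∈ A then ψ w else 0 := by
      intro w
      simp [ite_mul, Finset.sum_ite_eq']
    have h2 : ∑ z : A, (hopping x.1 z.1 : ℂ) * ψ z = 2 * d * ψ x - ∑ j : Fin d,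
        ((if x.1 + Pi.single j 1 ∈ A then ψ (x.1 + Pi.single j 1) else 0) +
          (if x.1 - Pi.single j 1 ∈ A then ψ (x.1 - Pi.single j 1) else 0)) := by
      rw [Finset.sum_coe_sort A fun z => (hopping x.1 z : ℂ) * ψ z]
      have h3 : ∀ z, (hopping x.1 z : ℂ) * ψ z = (if z = x.1 then 2 * (d : ℂ) * ψ z else 0) -
          ∑ j : Fin d, ((if z = x.1 + Pi.single j 1 then (1 : ℂ) else 0) * ψ z +
            (if z = x.1 - Pi.single j 1 then (1 : ℂ) else 0) * ψ z) := by
        intro z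
        simp only [← add_mul, ← Finset.sum_mul]
        rw [hopping]
        simp only [Complex.ofReal_sub, Complex.ofReal_sum, Complex.ofReal_add,
          apply_ite Complex.ofReal, Complex.ofReal_mul, Complex.ofReal_ofNat,
          Complex.ofReal_natCast, Complex.ofReal_zero, Complex.ofReal_one, sub_mul, ite_mul,
          zero_mul]
      simp only [h3]
      rw [Finset.sum_sub_distrib, Finset.sum_comm]
      simp only [Finset.sum_add_distrib, hind]
      rw [Finset.sum_ite_eq', if_pos x.2]
    simp only [h1]
    rw [Finset.sum_add_distrib, h2, Finset.sum_ite_eq, if_pos (Finset.mem_univ x)]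
    have h4 := h x.1
    change -laplacian ψ x.1 + (g : ℂ) * (v x.1 : ℂ) * ψ x.1 = E * ψ x.1 at h4
    have h5 : r x = ∑ j : Fin d, (ψ (x.1 + Pi.single j 1) + ψ (x.1 - Pi.single j 1)) - ∑ j : Fin d,
        ((if x.1 + Pi.single j 1 ∈ A then ψ (x.1 + Pi.single j 1) else 0) +
          (if x.1 - Pi.single j 1 ∈ A then ψ (x.1 - Pi.single j 1) else 0)) := by
      rw [← Finset.sum_sub_distrib]
      exact Finset.sum_congr rfl fun j _ => by split_ifs <;> ring
    have h6 : laplacian ψ x.1 =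
        ∑ j : Fin d, (ψ (x.1 + Pi.single j 1) + ψ (x.1 - Pi.single j 1)) - 2 * d * ψ x.1 := by
      rw [laplacian, Finset.sum_sub_distrib]
      simp; ring
    rw [h5]
    rw [h6] at h4
    linear_combination h4
  set y₀ : A := ⟨y, self_mem_box y L⟩ with hy₀
  have hrep : ψ y = ∑ x : A, ((M⁻¹ y₀ x : ℝ) : ℂ) * r x := by
    have h1 : ∀ z : A, ∑ x : A, M⁻¹ y₀ x * M x z = if y₀ = z then 1 else 0 := fun z => by
      rw [← Matrix.mul_apply, Matrix.nonsing_inv_mul _ (isUnit_iff_ne_zero.2 hdet),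
        Matrix.one_apply]
    simp only [← hMr, Finset.mul_sum]
    rw [Finset.sum_comm]
    simp only [← mul_assoc, ← Finset.sum_mul, ← Complex.ofReal_mul, ← Complex.ofReal_sum, h1]
    have h2 : ∀ z : A, (((if y₀ = z then 1 else 0 : ℝ)) : ℂ) * ψ z = if y₀ = z then ψ z else 0 :=
      fun z => by split_ifs <;> simp
    simp only [h2]
    rw [Finset.sum_ite_eq, if_pos (Finset.mem_univ _)]
  have hterm : ∀ x : A, ‖((M⁻¹ y₀ x : ℝ) : ℂ) * r x‖ ≤ 2 * d * Real.exp (-m * L) := by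
    intro x
    by_cases hx : (L : ℝ) ≤ ‖y - x.1‖
    · have hrx : ‖r x‖ ≤ 2 * d := by
        refine (norm_sum_le _ _).trans ?_
        calc _ ≤ ∑ _j : Fin d, (2 : ℝ) := by
              refine Finset.sum_le_sum fun j _ => (norm_add_le _ _).trans ?_
              have h1 : ‖if x.1 + Pi.single j 1 ∈ A then 0 else ψ (x.1 + Pi.single j 1)‖ ≤ 1 := by
                split_ifs
                · simp
                · exact hψ _
              have h2 : ‖if x.1 - Pi.single j 1 ∈ A then 0 else ψ (x.1 - Pi.single j 1)‖ ≤ 1 := by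
                split_ifs
                · simp
                · exact hψ _
              linarith
          _ = _ := by simp [mul_comm]
      rw [norm_mul, Complex.norm_real, Real.norm_eq_abs, mul_comm]
      gcongr
      exact hG x hx
    -- At distance less than `L` from the centre all neighbours stay in the box, because the norm is
    -- integer-valued; the source vanishes there.
    · have hin : ∀ w : Lattice d, ‖w‖ ≤ 1 → x.1 + w ∈ A := by
        intro w hw
        refine mem_box.2 ?_
        by_contra! hlt
        have h1 := add_one_le_norm_of_lt hlt
        rw [← sub_sub] at h1
        have h2 := norm_sub_le (y - x.1) w
        exact hx (by linarith)
      have hrx : r x = 0 := by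
        refine Finset.sum_eq_zero fun j _ => ?_
        rw [if_pos (hin _ (by rw [Pi.norm_single]; simp)), sub_eq_add_neg,
          if_pos (hin _ (by rw [norm_neg, Pi.norm_single]; simp)), add_zero]
      rw [hrx, mul_zero, norm_zero]
      positivity
  rw [hrep]
  refine (norm_sum_le _ _).trans ((Finset.sum_le_sum fun x _ => hterm x).trans (le_of_eq ?_))
  rw [Finset.sum_const, Finset.card_univ, Fintype.card_coe, card_box, nsmul_eq_mul]
  push_cast
  rfl

end Eigenfunctions

/-! ### Borel–Cantelli and decay of eigenfunctions. -/

section Localization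

variable {d : ℕ}

theorem summable_pow_mul_exp (c : ℝ) (p : ℕ) {a : ℝ} (ha : 0 < a) :
    Summable fun L : ℕ => (c * (L + 1)) ^ p * Real.exp (-a * L) := by
  have h := ((summable_nat_add_iff 1).2 (Real.summable_pow_mul_exp_neg_nat_mul p ha)).mul_left
    (c ^ p * Real.exp a)
  refine h.congr fun L => ?_
  have : Real.exp (-a * L) = Real.exp a * Real.exp (-a * (L + 1)) := by
    rw [← Real.exp_add]; congr 1; ring
  rw [this, mul_pow]
  push_cast
  ring

theorem tendsto_card_mul_exp (d : ℕ) {a : ℝ} (ha : 0 < a) :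
    Filter.Tendsto (fun L : ℕ => (2 * (L : ℝ) + 1) ^ d * (2 * d * Real.exp (-a * L))) Filter.atTop
      (nhds 0) := by
  have h := (summable_pow_mul_exp 2 d ha).tendsto_atTop_zero.const_mul (2 * (d : ℝ))
  rw [mul_zero] at h
  refine squeeze_zero (fun L => by positivity) (fun L => ?_) h
  calc _ ≤ (2 * ((L : ℝ) + 1)) ^ d * (2 * d * Real.exp (-a * L)) := by
        gcongr; linarith
    _ = _ := by ring

variable {Ω : Type*} [MeasurableSpace Ω] {P : Measure Ω} [IsProbabilityMeasure P]
  {V : Lattice d → Ω → ℝ}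

/-- Almost surely, for large `L` the cube of radius `L` around `x` and a cube of the same radius
at distance about `3 L` are not both singular at a common energy. -/
theorem ae_eventually_not_singular (hV_meas : ∀ x, Measurable (V x))
    (hV_indep : iIndepFun V P) (hV_ident : ∀ x, IdentDistrib (V x) (V 0) P P) {m g s R : ℝ}
    (h : ∀ A : Finset (Lattice d), StrongDisorder (P.map (V 0)) g s (2 * m + 3) (boxHopping A)
      (fun x y => ‖x.1 - y.1‖)) (hm : 0 ≤ m) (hR : 0 ≤ R) (x : Lattice d) :
    ∀ᵐ ω ∂P, ∀ᶠ L : ℕ in Filter.atTop, ∀ y ∈ box x (3 * L + 3), 2 * (L : ℝ) < ‖x - y‖ →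
      ∀ E, |E| ≤ R → Singular m g (fun i => V i ω) E x L →
        ¬ Singular m g (fun i => V i ω) E y L := by
  have hs := (h ∅).s_pos
  set S : ℕ → Set Ω := fun L => ⋃ y ∈ (box x (3 * L + 3)).filter (fun y => 2 * (L : ℝ) < ‖x - y‖),
    {ω | ∃ E, |E| ≤ R ∧ Singular m g (fun i => V i ω) E x L ∧
      Singular m g (fun i => V i ω) E y L} with hS
  have hbound : ∀ L, P (S L) ≤
      ENNReal.ofReal ((32 * R + 10) * ((7 * ((L : ℝ) + 1)) ^ (5 * d) * Real.exp (-s * L))) := by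
    intro L
    refine (measure_biUnion_finset_le _ _).trans ((Finset.sum_le_card_nsmul _ _ _ fun y hy =>
      measure_exists_singular_le hV_meas hV_indep hV_ident h hm hR
        (Finset.mem_filter.1 hy).2).trans ?_)
    rw [nsmul_eq_mul, ← ENNReal.ofReal_natCast, ← ENNReal.ofReal_mul (by positivity)]
    refine ENNReal.ofReal_le_ofReal ?_
    have hc : (((box x (3 * L + 3)).filter (fun y => 2 * (L : ℝ) < ‖x - y‖)).card : ℝ) ≤
        (7 * ((L : ℝ) + 1)) ^ d := by
      calc _ ≤ ((box x (3 * L + 3)).card : ℝ) := by exact_mod_cast Finset.card_filter_le _ _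
        _ ≤ _ := by
          rw [card_box]; push_cast
          gcongr
          linarith [(Nat.cast_nonneg L : (0 : ℝ) ≤ L)]
    calc _ ≤ (7 * ((L : ℝ) + 1)) ^ d *
          ((32 * R + 10) * (7 * ((L : ℝ) + 1)) ^ (4 * d) * Real.exp (-s * L)) := by
          gcongr
          linarith [(Nat.cast_nonneg L : (0 : ℝ) ≤ L)]
      _ = _ := by rw [show 5 * d = d + 4 * d by ring, pow_add]; ring
  -- Polynomially many centres `y` against `exp (-s * L)`: Borel–Cantelli applies.
  have hsum : ∑' L, P (S L) ≠ ∞ :=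
    ne_top_of_le_ne_top (((summable_pow_mul_exp 7 (5 * d) hs).mul_left
      (32 * R + 10)).tsum_ofReal_ne_top) (ENNReal.tsum_le_tsum hbound)
  filter_upwards [ae_eventually_notMem hsum] with ω hω
  filter_upwards [hω] with L hL y hy hxy E hE h1 h2
  exact hL (Set.mem_biUnion (Finset.mem_coe.2 (Finset.mem_filter.2 ⟨hy, hxy⟩)) ⟨E, hE, h1, h2⟩)

/-- The deterministic part: an eigenfunction decays as soon as the cube around a point of its
support prevents distant cubes from being singular. -/
theorem exists_radius_of_not_singular {m g E : ℝ} (hm : 0 < m) {v : Lattice d → ℝ}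
    {ψ : Lattice d → ℂ} (hψ : ∀ x, ‖ψ x‖ ≤ 1)
    (h : ∀ x, formalHamiltonian g v ψ x = (E : ℂ) * ψ x) {x : Lattice d} (hx : ψ x ≠ 0)
    (hsing : ∀ᶠ L : ℕ in Filter.atTop, ∀ y ∈ box x (3 * L + 3), 2 * (L : ℝ) < ‖x - y‖ →
      Singular (4 * m) g v E x L → ¬ Singular (4 * m) g v E y L) :
    ∃ R : ℝ, ∀ y : Lattice d, R ≤ ‖y‖ → ‖ψ y‖ ≤ Real.exp (-m * ‖y‖) := by
  -- `h1` forces the box at `x` to be singular. Of the rate `4m`, one `m` absorbs the volume factor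
  -- and the constant `exp (m * (‖x‖ + 3))` (`h2`); the other `3m` compensates for `L` being about a
  -- third of `‖x - y‖`.
  have h1 := (tendsto_card_mul_exp d (show 0 < 4 * m by linarith)).eventually_lt_const
    (norm_pos_iff.2 hx)
  have h2 := (tendsto_card_mul_exp d hm).eventually_lt_const
    (Real.exp_pos (-m * (‖x‖ + 3)))
  obtain ⟨L₀, hL₀⟩ := Filter.eventually_atTop.1 (hsing.and (h1.and h2))
  refine ⟨‖x‖ + 3 * (L₀ + 1), fun y hy => ?_⟩
  have hxy : 3 * ((L₀ : ℝ) + 1) ≤ ‖x - y‖ := by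
    have := norm_sub_norm_le y x
    rw [norm_sub_rev] at this
    linarith
  set L := ⌊‖x - y‖ / 3⌋₊ with hL
  have hLle : (L : ℝ) ≤ ‖x - y‖ / 3 := Nat.floor_le (by positivity)
  have hLlt : ‖x - y‖ / 3 < L + 1 := Nat.lt_floor_add_one _
  have hLL₀ : L₀ ≤ L := Nat.le_floor (by linarith)
  obtain ⟨ha, hb, hc⟩ := hL₀ L hLL₀
  have hsx : Singular (4 * m) g v E x L := by
    by_contra hns
    exact (norm_le_of_not_singular hψ h hns).not_gt (by simpa using hb)
  have hL0 : (0 : ℝ) ≤ L₀ := Nat.cast_nonneg _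
  have hns := ha y (mem_box.2 (by push_cast; linarith)) (by linarith) hsx
  have hyn : ‖y‖ ≤ ‖x‖ + 3 + 3 * L := by
    have := norm_sub_norm_le y x
    rw [norm_sub_rev] at this
    linarith
  calc ‖ψ y‖ ≤ (2 * L + 1) ^ d * (2 * d * Real.exp (-(4 * m) * L)) :=
        norm_le_of_not_singular hψ h hns
    _ = ((2 * L + 1) ^ d * (2 * d * Real.exp (-m * L))) * Real.exp (-(3 * m) * L) := by
        rw [show -(4 * m) * (L : ℝ) = -m * L + -(3 * m) * L by ring, Real.exp_add]; ring
    _ ≤ Real.exp (-m * (‖x‖ + 3)) * Real.exp (-(3 * m) * L) := by gcongr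
    _ ≤ _ := by
        rw [← Real.exp_add]
        exact Real.exp_le_exp.2 (by nlinarith)

end Localization

end Anderson

theorem mainTheorem3 {d : ℕ} {Ω : Type*} [MeasurableSpace Ω]
    (P : Measure Ω) [IsProbabilityMeasure P]
    (V : Anderson.Lattice d → Ω → ℝ)
    (hV_meas : ∀ x, Measurable (V x))
    (hV_indep : iIndepFun V P)
    (hV_ident : ∀ x, IdentDistrib (V x) (V 0) P P)
    (hV_holder : Anderson.UniformlyHolder (Anderson.distributionFunction P (V 0)))
    (m : ℝ) (hm : 0 < m) :
    ∃ g₀ : ℝ, ∀ g : ℝ, g₀ ≤ |g| →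
      ∀ᵐ ω ∂P, ∀ ψ : Anderson.EllTwo d,
        Anderson.IsNormalizedEigenfunction (Anderson.hamiltonian g (fun x => V x ω)) ψ →
          ∃ R : ℝ, ∀ y : Anderson.Lattice d, R ≤ ‖y‖ → ‖ψ y‖ ≤ Real.exp (-m * ‖y‖) := by
  have : IsProbabilityMeasure (P.map (V 0)) :=
    Measure.isProbabilityMeasure_map (hV_meas 0).aemeasurable
  have hholder : Anderson.UniformlyHolder fun t => (P.map (V 0)).real (Set.Iic t) := by
    convert hV_holder using 2 with t
    rw [map_measureReal_apply (hV_meas 0) measurableSet_Iic]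
    rfl
  obtain ⟨s, hs, hs1, C₀, hC₀, hC⟩ := Anderson.exists_lintegral_enorm_rpow_le hholder
  obtain ⟨g₀, hg₀⟩ := Anderson.exists_coupling_lintegral_le hs hC₀ hC
    (η := Real.exp (-(2 * (4 * m) + 3)) / (2 * d + 1)) (by positivity)
  refine ⟨g₀, fun g hg => ?_⟩
  have hSD := fun A : Finset (Anderson.Lattice d) =>
    Anderson.strongDisorder_boxHopping hs hs1 (by positivity) (hg₀ g hg) A
  -- Countably many `x` and energy cutoffs `N` give one null set serving all eigenfunctions and all
  -- real energies.
  have hae : ∀ᵐ ω ∂P, ∀ (x : Anderson.Lattice d) (N : ℕ), ∀ᶠ L : ℕ in Filter.atTop,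
      ∀ y ∈ Anderson.box x (3 * L + 3), 2 * (L : ℝ) < ‖x - y‖ → ∀ E, |E| ≤ (N : ℝ) →
        Anderson.Singular (4 * m) g (fun i => V i ω) E x L →
          ¬ Anderson.Singular (4 * m) g (fun i => V i ω) E y L :=
    ae_all_iff.2 fun x => ae_all_iff.2 fun N =>
      Anderson.ae_eventually_not_singular hV_meas hV_indep hV_ident hSD (by positivity)
        (Nat.cast_nonneg N) x
  filter_upwards [hae] with ω hω ψ hψ
  obtain ⟨hnorm, hdom, E, hE⟩ := hψ
  have heq : ∀ x, Anderson.formalHamiltonian g (fun x => V x ω) ψ x = E * ψ x := fun x =>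
    congrArg (fun φ : Anderson.EllTwo d => φ x) hE
  have hψ1 : ∀ x, ‖ψ x‖ ≤ 1 := fun x =>
    (lp.norm_apply_le_norm (by norm_num) ψ x).trans hnorm.le
  have hψ0 : (ψ : Anderson.Lattice d → ℂ) ≠ 0 := fun h0 => by
    have : ψ = 0 := lp.ext h0
    rw [this, norm_zero] at hnorm
    exact zero_ne_one hnorm
  have hsq : Summable fun x => ‖ψ x‖ ^ 2 := by
    have := (lp.memℓp ψ).summable (by norm_num)
    simpa using this
  have hEim := Anderson.eigenvalue_im_eq_zero hψ0 hsq heq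
  have hEre : E = (E.re : ℂ) := Complex.ext rfl (by simpa using hEim)
  rw [hEre] at heq
  obtain ⟨x, hx⟩ := Function.ne_iff.1 hψ0
  obtain ⟨N, hN⟩ := exists_nat_ge |E.re|
  refine Anderson.exists_radius_of_not_singular hm hψ1 heq hx ?_
  filter_upwards [hω x N] with L hL y hy hxy
  exact hL y hy hxy E.re hN
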